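/- **Setting.** Let $n\ge 2$, $A\in\mathbb R^{n\times n}$, $\epsilon>0$. Let $\mathcal E_p\subset\{1,\dots,n\}^2$ and, for $(i,j)\in\mathcal E_p$, let $\underline\Delta_{ij}\in\mathbb R_{\le 0}\cup\{-\infty\}$ and $\bar\Delta_{ij}\in\mathbb R_{\ge 0}\cup\{+\infty\}$. Let $\mathcal H$ be the set of $\Delta\in\mathbb R^{n\times n}$ with $\Delta_{ij}=0$ for $(i,j)\notin\mathcal E_p$ and $\Delta_{ij}\in[\underline\Delta_{ij},\bar\Delta_{ij}]$ for $(i,j)\in\mathcal E_p$, and let $\mathbb B_\epsilon$ be the closed ball of radius $\epsilon$ in the Frobenius norm. Write $\alpha(B)$ for the largest real part of an eigenvalue of $B$ (an eigenvalue attaining it is called rightmost) and $\alpha_{\epsilon,\mathcal H}(A)$ for the largest real part of an eigenvalue of $A+\Delta$ over all $\Delta\in\mathcal H\cap\mathbb B_\epsilon$. Vectors $x,y\in\mathbb C^n$ are RP-compatible if $|x|=|y|=1$ and $x^*y$ is real and positive; right and left eigenvectors satisfy $Bx=\lambda x$, $y^*B=\lambda y^*$. Let $\langle\Delta,M\rangle=\operatorname{Tr}(\Delta^{T}M)$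 for real matrices. **Algorithm 1** (input $\epsilon$, $M=[m_{ij}]\in\mathbb R^{n\times n}$, $\mathcal H$). Start with $\bar S=\underline S=\emptyset$ and repeat: if $\bar S\cup\underline S=\mathcal E_p$, stop with an error. Otherwise put $$\theta=\sqrt{\Big(\epsilon^2-\sum_{\bar S}\bar\Delta_{ij}^2-\sum_{\underline S}\underline\Delta_{ij}^2\Big)\Big/\sum_{\mathcal E_p\setminus(\bar S\cup\underline S)}m_{ij}^2}\,,$$ and, among the edges of $\mathcal E_p\setminus(\bar S\cup\underline S)$, add to $\bar S$ all those with $m_{ij}\theta\ge\bar\Delta_{ij}$ and to $\underline S$ all the others with $m_{ij}\theta\le\underline\Delta_{ij}$. If no edge was added, output $\theta$ and the matrix $\Delta$ with entries $\bar\Delta_{ij}$ on $\bar S$, $\underline\Delta_{ij}$ on $\underline S$, $m_{ij}\theta$ on the rest of $\mathcal E_p$, and $0$ outside $\mathcal E_p$. **Algorithm 2** (input $\Delta_0\in\mathbb R^{n\times n}$ and a tolerance $\epsilon_{\rm tol}>0$). For $k=0,1,\dots$ take any rightmost eigenvalue $\lambda_k$ of $A+\Delta_k$ with RP-compatible right and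 left eigenvectors $x_k,y_k$, and let $\Delta_{k+1}$ be the output of Algorithm 1 for $M=\operatorname{Re}(y_kx_k^*)$. Terminate at the $k$-th iteration if $\|\Delta_{k+1}-\Delta_k\|_F\le\epsilon_{\rm tol}$, with output $\alpha=\operatorname{Re}\lambda_{k+1}$, where $\lambda_{k+1}$ is a rightmost eigenvalue of $A+\Delta_{k+1}$. **Theorem (Local convergence of Algorithm 2).** Let $\Delta_{\rm opt}$ maximize $\alpha(A+\Delta)$ over $\Delta\in\mathcal H\cap\mathbb B_\epsilon$. Suppose that the rightmost eigenvalue $\lambda$ of $A+\Delta_{\rm opt}$ is unique up to complex conjugation and simple (of algebraic multiplicity one). Let $x,y$ be RP-compatible right and left eigenvectors of $A+\Delta_{\rm opt}$ for $\lambda$, put $M=\operatorname{Re}(yx^*)$, and suppose that there is $(i,j)\in\mathcal E_p$ with $(\Delta_{\rm opt})_{ij}\in(\underline\Delta_{ij},\bar\Delta_{ij})$ and $m_{ij}\ne 0$. Suppose also that $\sigma_{n-1}(A-\lambda I)>0$, where $\sigma_{n-1}$ is the second smallest singular value. Call $c>0$ a *sensitivity constant* if there is $\delta>0$ such that $\|\tilde\Delta-\Delta_{\rm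 opt}\|_F\le c\,\epsilon\,\|\tilde M-M\|_F$ for each $\tilde M\in\mathbb R^{n\times n}$ with $\|\tilde M\|_F\le 1$, $\|\tilde M-M\|_F\le\delta$ and each maximizer $\tilde\Delta$ of $\langle\Delta,\tilde M\rangle$ over $\Delta\in\mathcal H\cap\mathbb B_\epsilon$. Then a sensitivity constant exists. Moreover there is a constant $K>0$, depending only on $A,\mathcal H,\epsilon,\Delta_{\rm opt},\lambda,x,y$, such that for every sensitivity constant $c$ for which $$r=\frac{4\sqrt n\,c\,\epsilon}{\sigma_{n-1}(A-\lambda I)\,(y^*x)^2}<1$$ there is $\rho>0$ with the following properties. 1. If $\Delta\in\mathbb R^{n\times n}$ and $\|\Delta-\Delta_{\rm opt}\|_2<\rho$, a step of Algorithm 2 from $\Delta$ can always be carried out: every rightmost eigenvalue of $A+\Delta$ has RP-compatible right and left eigenvectors, and, for every choice of them, Algorithm 1 ends without error with a matrix $\Delta'$ that again satisfies $\|\Delta'-\Delta_{\rm opt}\|_2<\rho$. 2. If $\|\Delta_0-\Delta_{\rm opt}\|_2<\rho$, then all sequences $\Delta_k$, $\lambda_k$ generated by Algorithm 2 (run without stopping)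 satisfy, for all $k\ge 0$, $$\|\Delta_{k+1}-\Delta_{\rm opt}\|_F\le r\,\|\Delta_k-\Delta_{\rm opt}\|_F,\qquad |\operatorname{Re}\lambda_k-\alpha_{\epsilon,\mathcal H}(A)|\le K\,r^k\,\|\Delta_0-\Delta_{\rm opt}\|_F ;$$ in particular $\Delta_k\to\Delta_{\rm opt}$ and $\operatorname{Re}\lambda_k\to\alpha_{\epsilon,\mathcal H}(A)$. 3. For such sequences, every $\epsilon_{\rm tol}>0$ and every $k$ with $\|\Delta_{k+1}-\Delta_k\|_F\le\epsilon_{\rm tol}$ (in particular the $k$ at which Algorithm 2 terminates), $\alpha=\operatorname{Re}\lambda_{k+1}$ satisfies $$|\alpha-\alpha_{\epsilon,\mathcal H}(A)|\le K\,\frac{r}{1-r}\,\epsilon_{\rm tol}.$$ -/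

import Mathlib

open scoped Matrix

noncomputable section

namespace StructuredPseudospectrum

/-! Norms and inner product on real matrices; complexification; singular values. -/

/-- Frobenius norm of a real matrix. -/
def frobNorm {n : ℕ} (M : Matrix (Fin n) (Fin n) ℝ) : ℝ :=
  Real.sqrt (∑ i, ∑ j, M i j ^ 2)

/-- Induced (operator) 2-norm of a real matrix. -/
def twoNorm {n : ℕ} (M : Matrix (Fin n) (Fin n) ℝ) : ℝ :=
  ‖Matrix.toEuclideanCLM (n := Fin n) (𝕜 := ℝ) M‖

/-- Matrix inner product `⟨A, B⟩ = Tr (Aᵀ B)` of real matrices. -/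
def matInner {n : ℕ} (A B : Matrix (Fin n) (Fin n) ℝ) : ℝ := (Aᵀ * B).trace

/-- A real matrix viewed as a complex one. -/
def toC {n : ℕ} (A : Matrix (Fin n) (Fin n) ℝ) : Matrix (Fin n) (Fin n) ℂ :=
  A.map Complex.ofReal

/-- The second smallest singular value `σ_{n-1}` (singular values `σ_1 ≥ … ≥ σ_n`) of a complex
`n × n` matrix, `n ≥ 2`. Mathlib's sequence of singular values is non-increasing and zero-indexed,
so that `σ_{n-1}` has index `n - 2`. -/
def secondSmallestSingularValue {n : ℕ} (M : Matrix (Fin n) (Fin n) ℂ) : ℝ :=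
  (Matrix.toEuclideanLin M).singularValues (n - 2)

/-! Spectral abscissa, eigenvectors. -/

/-- Spectral abscissa: the largest real part of a (complex) eigenvalue of a real matrix. -/
def abscissa {n : ℕ} (A : Matrix (Fin n) (Fin n) ℝ) : ℝ :=
  sSup (Complex.re '' spectrum ℂ (toC A))

/-- `lam` is a rightmost eigenvalue of `A`. -/
def IsRightmost {n : ℕ} (A : Matrix (Fin n) (Fin n) ℝ) (lam : ℂ) : Prop :=
  lam ∈ spectrum ℂ (toC A) ∧ lam.re = abscissa A

/-- `x`, `y` are RP-compatible: `|x| = |y| = 1` and `x^* y` is real and positive. -/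
def RPCompatible {n : ℕ} (x y : Fin n → ℂ) : Prop :=
  star x ⬝ᵥ x = 1 ∧ star y ⬝ᵥ y = 1 ∧ (star x ⬝ᵥ y).im = 0 ∧ 0 < (star x ⬝ᵥ y).re

/-- `x`, `y` are RP-compatible right and left eigenvectors of `A` for the eigenvalue `lam`:
`A x = lam x`, `y^* A = lam y^*`. -/
def IsRPEigenpair {n : ℕ} (A : Matrix (Fin n) (Fin n) ℝ) (lam : ℂ) (x y : Fin n → ℂ) : Prop :=
  toC A *ᵥ x = lam • x ∧ star y ᵥ* toC A = lam • star y ∧ RPCompatible x y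

/-- The real matrix `Re (y x^*)`. -/
def reOuter {n : ℕ} (x y : Fin n → ℂ) : Matrix (Fin n) (Fin n) ℝ :=
  fun i j => (y i * star (x j)).re

/-! The structured perturbation set and the worst-case perturbations. -/

/-- Data of a structured perturbation set: the perturbation edges `E_p`, and on each edge a lower
saturation bound in `ℝ_{≤ 0} ∪ {-∞}` and an upper one in `ℝ_{≥ 0} ∪ {+∞}`. -/
structure PertStructure (n : ℕ) where
  edges : Finset (Fin n × Fin n)
  lo : Fin n × Fin n → EReal
  hi : Fin n × Fin n → EReal
  lo_nonpos : ∀ e ∈ edges, lo e ≤ 0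
  hi_nonneg : ∀ e ∈ edges, 0 ≤ hi e

variable {n : ℕ}

/-- The set `H` of allowed perturbations. -/
def PertStructure.allowed (S : PertStructure n) : Set (Matrix (Fin n) (Fin n) ℝ) :=
  {D | (∀ e, e ∉ S.edges → D e.1 e.2 = 0) ∧
    ∀ e ∈ S.edges, S.lo e ≤ (D e.1 e.2 : EReal) ∧ (D e.1 e.2 : EReal) ≤ S.hi e}

/-- `H ∩ B_ε`, with `B_ε` the closed Frobenius ball. -/
def feasible (S : PertStructure n) (ε : ℝ) : Set (Matrix (Fin n) (Fin n) ℝ) :=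
  {D | D ∈ S.allowed ∧ frobNorm D ≤ ε}

/-- The structured `ε`-pseudospectrum `Λ_{ε,H}(A)`. -/
def structPseudospectrum (A : Matrix (Fin n) (Fin n) ℝ) (S : PertStructure n) (ε : ℝ) : Set ℂ :=
  {z | ∃ D ∈ feasible S ε, z ∈ spectrum ℂ (toC (A + D))}

/-- The structured `ε`-pseudospectral abscissa `α_{ε,H}(A)`. -/
def structAbscissa (A : Matrix (Fin n) (Fin n) ℝ) (S : PertStructure n) (ε : ℝ) : ℝ :=
  sSup (Complex.re '' structPseudospectrum A S ε)

/-- `D` is a worst-case structured perturbation of energy `ε`: it maximizes `α(A + D)` over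
`H ∩ B_ε`. -/
def IsWorstCase (A : Matrix (Fin n) (Fin n) ℝ) (S : PertStructure n) (ε : ℝ)
    (D : Matrix (Fin n) (Fin n) ℝ) : Prop :=
  D ∈ feasible S ε ∧ ∀ D' ∈ feasible S ε, abscissa (A + D') ≤ abscissa (A + D)

/-! The linear problem `max ⟨D, M⟩` over `H ∩ B_ε`. -/

/-- `D` is an optimizer of: maximize `⟨D, M⟩` subject to `D ∈ H ∩ B_ε`. -/
def IsOptimizer (S : PertStructure n) (ε : ℝ) (M D : Matrix (Fin n) (Fin n) ℝ) : Prop :=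
  D ∈ feasible S ε ∧ ∀ D' ∈ feasible S ε, matInner D' M ≤ matInner D M

/-- Non-saturation of `D` with respect to `M`: some edge is not saturated by `D` and has a
nonzero entry in `M`. -/
def NonSaturated (S : PertStructure n) (M D : Matrix (Fin n) (Fin n) ℝ) : Prop :=
  ∃ e ∈ S.edges, S.lo e < (D e.1 e.2 : EReal) ∧ (D e.1 e.2 : EReal) < S.hi e ∧ M e.1 e.2 ≠ 0

/-- `c > 0` is a sensitivity constant at `(M, D)`: for some `δ > 0`, each optimizer `D'` of the
linear problem for a matrix `M'` in the Frobenius unit ball with `‖M' - M‖_F ≤ δ` satisfies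
`‖D' - D‖_F ≤ c ε ‖M' - M‖_F`. -/
def IsSensitivityConstant (S : PertStructure n) (ε : ℝ) (M D : Matrix (Fin n) (Fin n) ℝ)
    (c : ℝ) : Prop :=
  0 < c ∧ ∃ δ > 0, ∀ M' : Matrix (Fin n) (Fin n) ℝ, frobNorm M' ≤ 1 → frobNorm (M' - M) ≤ δ →
    ∀ D' : Matrix (Fin n) (Fin n) ℝ, IsOptimizer S ε M' D' →
      frobNorm (D' - D) ≤ c * ε * frobNorm (M' - M)

/-! The incremental construction of the saturation index sets. -/

/-- The ratio `θ(ε, M, Su, Sl)` for index sets `Su`, `Sl` of upper and lower saturation. -/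
def theta (S : PertStructure n) (ε : ℝ) (M : Matrix (Fin n) (Fin n) ℝ)
    (Su Sl : Finset (Fin n × Fin n)) : ℝ :=
  Real.sqrt ((ε ^ 2 - ∑ e ∈ Su, (S.hi e).toReal ^ 2 - ∑ e ∈ Sl, (S.lo e).toReal ^ 2) /
    ∑ e ∈ S.edges \ (Su ∪ Sl), M e.1 e.2 ^ 2)

open Classical in
/-- Edges newly found to be saturated from above in one pass with ratio `t`. -/
def newUpper (S : PertStructure n) (M : Matrix (Fin n) (Fin n) ℝ)
    (Su Sl : Finset (Fin n × Fin n)) (t : ℝ) : Finset (Fin n × Fin n) :=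
  (S.edges \ (Su ∪ Sl)).filter fun e => S.hi e ≤ ((M e.1 e.2 * t : ℝ) : EReal)

open Classical in
/-- Edges newly found to be saturated from below (and not from above) in one pass. -/
def newLower (S : PertStructure n) (M : Matrix (Fin n) (Fin n) ℝ)
    (Su Sl : Finset (Fin n × Fin n)) (t : ℝ) : Finset (Fin n × Fin n) :=
  (S.edges \ (Su ∪ Sl)).filter fun e =>
    ¬ S.hi e ≤ ((M e.1 e.2 * t : ℝ) : EReal) ∧ ((M e.1 e.2 * t : ℝ) : EReal) ≤ S.lo e

/-- The perturbation assembled from the saturation sets and the ratio `t`. -/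
def assemble (S : PertStructure n) (M : Matrix (Fin n) (Fin n) ℝ)
    (Su Sl : Finset (Fin n × Fin n)) (t : ℝ) : Matrix (Fin n) (Fin n) ℝ :=
  fun i j =>
    if (i, j) ∈ Su then (S.hi (i, j)).toReal
    else if (i, j) ∈ Sl then (S.lo (i, j)).toReal
    else if (i, j) ∈ S.edges then M i j * t
    else 0

/-- The main loop; `none` is the error exit (all edges are saturated). The first argument bounds
the number of passes. -/
def saturationLoop (S : PertStructure n) (ε : ℝ) (M : Matrix (Fin n) (Fin n) ℝ) :
    ℕ → Finset (Fin n × Fin n) → Finset (Fin n × Fin n) →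
      Option (ℝ × Matrix (Fin n) (Fin n) ℝ)
  | 0, _, _ => none
  | k + 1, Su, Sl =>
    if Su ∪ Sl = S.edges then none
    else if newUpper S M Su Sl (theta S ε M Su Sl) = ∅ ∧
        newLower S M Su Sl (theta S ε M Su Sl) = ∅ then
      some (theta S ε M Su Sl, assemble S M Su Sl (theta S ε M Su Sl))
    else
      saturationLoop S ε M k (Su ∪ newUpper S M Su Sl (theta S ε M Su Sl))
        (Sl ∪ newLower S M Su Sl (theta S ε M Su Sl))

/-- The index-set algorithm, with output `(θ, D)` or an error. Every pass that does not end the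
loop saturates a further edge, so `|E_p| + 1` passes are never exceeded. -/
def indexSetAlgorithm (S : PertStructure n) (ε : ℝ) (M : Matrix (Fin n) (Fin n) ℝ) :
    Option (ℝ × Matrix (Fin n) (Fin n) ℝ) :=
  saturationLoop S ε M (S.edges.card + 1) ∅ ∅

/-! The fixed-point iteration. -/

/-- `D`, `lam`, `x`, `y` are sequences generated by the fixed-point iteration: `lam k` is a (any)
rightmost eigenvalue of `A + D k`, `x k`, `y k` are RP-compatible right and left eigenvectors for
it, and `D (k + 1)` is the output of the index-set algorithm for `M = Re (y_k x_k^*)`. -/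
def IsIteration (A : Matrix (Fin n) (Fin n) ℝ) (S : PertStructure n) (ε : ℝ)
    (D : ℕ → Matrix (Fin n) (Fin n) ℝ) (lam : ℕ → ℂ) (x y : ℕ → Fin n → ℂ) : Prop :=
  ∀ k, IsRightmost (A + D k) (lam k) ∧ IsRPEigenpair (A + D k) (lam k) (x k) (y k) ∧
    ∃ t, indexSetAlgorithm S ε (reOuter (x k) (y k)) = some (t, D (k + 1))

/-- The rate `r = 4 √n c ε / (σ_{n-1}(A - lam I) (y^* x)^2)`. -/
def rate (A : Matrix (Fin n) (Fin n) ℝ) (ε c : ℝ) (lam : ℂ) (x y : Fin n → ℂ) : ℝ :=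
  4 * Real.sqrt n * c * ε /
    (secondSmallestSingularValue (toC A - lam • (1 : Matrix (Fin n) (Fin n) ℂ)) *
      (star y ⬝ᵥ x).re ^ 2)

end StructuredPseudospectrum

end

namespace StructuredPseudospectrum

open Filter Topology

variable {n : ℕ}

/-! ### Frobenius norm and inner product -/

/-! One step of the iteration is a composition of two maps, and the proof bounds the Lipschitz
constant of each near `Dopt`: from `D` to `Re (v u^*)` (eigenvector perturbation), and from that
matrix to the optimizer of the linear problem. Their product is at most `r`, so the step is a
contraction with fixed point `Dopt`.

The fixed-point property is first-order optimality. A simple eigenvalue moves along `W` with `τ Re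
λ' = ⟨W, M⟩`, `τ = y^* x`, and the feasible set is convex; hence a worst-case perturbation maximizes
`⟨·, M⟩` (`IsWorstCase.isOptimizer`). Non-saturation supplies a multiplier `θ > 0` such that `Dopt`
is the projection of `θ M` onto `H` (`IsOptimizer.exists_multiplier`). This gives quadratic growth,
whence the optimizers depend Lipschitz-continuously on `M` and a sensitivity constant exists. It
also shows that the index-set algorithm never marks an edge wrongly, hence returns the optimizer
(`saturationLoop_eq`).

For the eigenvectors, let `s` bound `A + Dopt - λ` from below on the complement of `x`. Then
`IsSimplePair.rank_one_bound` gives the Lipschitz constant `(9/2) / (s τ²)`. Weyl-type reasoning on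
a hyperplane yields `s = σ - ε` with `σ = σ_{n-1}(A - λ)`, which is useful only if `ε` is small
against `σ`. This follows from `r < 1` as soon as `c ≥ 1`. By `IsSensitivityConstant.one_le_or`,
either `c ≥ 1`, or the optimizer is locally constant; in the latter case the step lands exactly on
`Dopt`, and any positive `s`, such as the one coming from simplicity, will do. -/

/-- The entries of a real matrix as a Euclidean vector. -/
noncomputable def entries (M : Matrix (Fin n) (Fin n) ℝ) : EuclideanSpace ℝ (Fin n × Fin n) :=
  WithLp.toLp 2 fun e => M e.1 e.2

theorem entries_add (M N : Matrix (Fin n) (Fin n) ℝ) : entries (M + N) = entries M + entries N :=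
  rfl

theorem entries_sub (M N : Matrix (Fin n) (Fin n) ℝ) : entries (M - N) = entries M - entries N :=
  rfl

theorem entries_smul (t : ℝ) (M : Matrix (Fin n) (Fin n) ℝ) : entries (t • M) = t • entries M :=
  rfl

theorem frobNorm_eq (M : Matrix (Fin n) (Fin n) ℝ) : frobNorm M = ‖entries M‖ := by
  simp [frobNorm, EuclideanSpace.norm_eq, entries, Fintype.sum_prod_type]

theorem matInner_eq (M N : Matrix (Fin n) (Fin n) ℝ) :
    matInner M N = inner ℝ (entries M) (entries N) := by
  simp only [matInner, Matrix.trace, Matrix.diag, Matrix.mul_apply, Matrix.transpose_apply,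
    PiLp.inner_apply, entries, Fintype.sum_prod_type]
  rw [Finset.sum_comm]
  simp [mul_comm]

theorem matInner_eq_sum (M N : Matrix (Fin n) (Fin n) ℝ) :
    matInner M N = ∑ e : Fin n × Fin n, M e.1 e.2 * N e.1 e.2 := by
  simp [matInner_eq, PiLp.inner_apply, entries, mul_comm]

theorem frobNorm_sq (M : Matrix (Fin n) (Fin n) ℝ) :
    frobNorm M ^ 2 = ∑ e : Fin n × Fin n, M e.1 e.2 ^ 2 := by
  simp [frobNorm_eq, EuclideanSpace.norm_sq_eq, entries]

theorem frobNorm_nonneg (M : Matrix (Fin n) (Fin n) ℝ) : 0 ≤ frobNorm M := Real.sqrt_nonneg _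

theorem frobNorm_zero : frobNorm (0 : Matrix (Fin n) (Fin n) ℝ) = 0 := by simp [frobNorm]

theorem frobNorm_smul (t : ℝ) (M : Matrix (Fin n) (Fin n) ℝ) :
    frobNorm (t • M) = |t| * frobNorm M := by
  simp [frobNorm_eq, entries_smul, norm_smul]

theorem frobNorm_sub_comm (M N : Matrix (Fin n) (Fin n) ℝ) :
    frobNorm (M - N) = frobNorm (N - M) := by
  simp only [frobNorm_eq, entries_sub, norm_sub_rev]

theorem frobNorm_add_le (M N : Matrix (Fin n) (Fin n) ℝ) :
    frobNorm (M + N) ≤ frobNorm M + frobNorm N := by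
  simpa only [frobNorm_eq, entries_add] using norm_add_le _ _

theorem matInner_le (M N : Matrix (Fin n) (Fin n) ℝ) :
    matInner M N ≤ frobNorm M * frobNorm N := by
  simpa only [frobNorm_eq, matInner_eq] using real_inner_le_norm _ _

theorem abs_apply_le_frobNorm (M : Matrix (Fin n) (Fin n) ℝ) (i j : Fin n) :
    |M i j| ≤ frobNorm M := by
  rw [frobNorm_eq]
  exact PiLp.norm_apply_le (entries M) (i, j)

theorem matInner_add_left (M N P : Matrix (Fin n) (Fin n) ℝ) :
    matInner (M + N) P = matInner M P + matInner N P := by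
  simp only [matInner_eq, entries_add, inner_add_left]

theorem matInner_sub_left (M N P : Matrix (Fin n) (Fin n) ℝ) :
    matInner (M - N) P = matInner M P - matInner N P := by
  simp only [matInner_eq, entries_sub, inner_sub_left]

theorem matInner_sub_right (M N P : Matrix (Fin n) (Fin n) ℝ) :
    matInner M (N - P) = matInner M N - matInner M P := by
  simp only [matInner_eq, entries_sub, inner_sub_right]

theorem matInner_smul_left (t : ℝ) (M N : Matrix (Fin n) (Fin n) ℝ) :
    matInner (t • M) N = t * matInner M N := by
  simp only [matInner_eq, entries_smul, real_inner_smul_left]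

theorem matInner_comm (M N : Matrix (Fin n) (Fin n) ℝ) : matInner M N = matInner N M := by
  simp only [matInner_eq, real_inner_comm]

theorem matInner_self (M : Matrix (Fin n) (Fin n) ℝ) : matInner M M = frobNorm M ^ 2 := by
  rw [matInner_eq, frobNorm_eq, real_inner_self_eq_norm_sq]

theorem frobNorm_add_sq (M N : Matrix (Fin n) (Fin n) ℝ) :
    frobNorm (M + N) ^ 2 = frobNorm M ^ 2 + 2 * matInner M N + frobNorm N ^ 2 := by
  simp only [frobNorm_eq, entries_add, matInner_eq, norm_add_sq_real]

theorem frobNorm_sub_sq (M N : Matrix (Fin n) (Fin n) ℝ) :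
    frobNorm (M - N) ^ 2 = frobNorm M ^ 2 - 2 * matInner M N + frobNorm N ^ 2 := by
  simp only [frobNorm_eq, entries_sub, matInner_eq, norm_sub_sq_real]

/-- The matrix unit at an edge. -/
def unit (e : Fin n × Fin n) : Matrix (Fin n) (Fin n) ℝ := Matrix.single e.1 e.2 1

theorem unit_apply (e f : Fin n × Fin n) : unit e f.1 f.2 = if f = e then (1 : ℝ) else 0 := by
  simp only [unit, Matrix.single_apply, Prod.ext_iff]
  simp only [eq_comm]

theorem unit_apply_self (e : Fin n × Fin n) : unit e e.1 e.2 = 1 := by simp [unit_apply]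

theorem matInner_unit (M : Matrix (Fin n) (Fin n) ℝ) (e : Fin n × Fin n) :
    matInner M (unit e) = M e.1 e.2 := by
  simp [matInner_eq_sum, unit_apply]

/-- Every neighbourhood of a matrix contains a Frobenius ball. -/
theorem exists_frobNorm_ball {p : Matrix (Fin n) (Fin n) ℝ → Prop} {M : Matrix (Fin n) (Fin n) ℝ}
    (h : ∀ᶠ N in 𝓝 M, p N) : ∃ η > 0, ∀ N, frobNorm (N - M) < η → p N := by
  have key : Tendsto (fun v : EuclideanSpace ℝ (Fin n × Fin n) =>
      (fun i j => v (i, j) : Matrix (Fin n) (Fin n) ℝ)) (𝓝 (entries M)) (𝓝 M) := by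
    have : Continuous fun v : EuclideanSpace ℝ (Fin n × Fin n) =>
      (fun i j => v (i, j) : Matrix (Fin n) (Fin n) ℝ) := by fun_prop
    exact this.tendsto (entries M)
  obtain ⟨η, hη, hb⟩ := Metric.eventually_nhds_iff.1 (key.eventually h)
  refine ⟨η, hη, fun N hN => hb (y := entries N) ?_⟩
  rwa [dist_eq_norm, ← entries_sub, ← frobNorm_eq]

theorem tendsto_of_frobNorm {ι : Type*} {l : Filter ι} {D : ι → Matrix (Fin n) (Fin n) ℝ}
    {M : Matrix (Fin n) (Fin n) ℝ} (h : Tendsto (fun k => frobNorm (D k - M)) l (𝓝 0)) :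
    Tendsto D l (𝓝 M) := by
  refine tendsto_pi_nhds.2 fun i => tendsto_pi_nhds.2 fun j => ?_
  rw [tendsto_iff_norm_sub_tendsto_zero]
  exact squeeze_zero (fun _ => norm_nonneg _)
    (fun k => abs_apply_le_frobNorm (D k - M) i j) h

/-! ### The feasible set -/

variable {S : PertStructure n} {ε : ℝ} {M D : Matrix (Fin n) (Fin n) ℝ}

theorem zero_mem_allowed : (0 : Matrix (Fin n) (Fin n) ℝ) ∈ S.allowed :=
  ⟨fun _ _ => rfl, fun e he => ⟨by simpa using S.lo_nonpos e he, by simpa using S.hi_nonneg e he⟩⟩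

theorem zero_mem_feasible (hε : 0 ≤ ε) : (0 : Matrix (Fin n) (Fin n) ℝ) ∈ feasible S ε :=
  ⟨zero_mem_allowed, by rwa [frobNorm_zero]⟩

/-- Real numbers between two extended reals form a convex set. -/
theorem ereal_between_convex {lo hi : EReal} {a b t : ℝ} (ha : lo ≤ a ∧ (a : EReal) ≤ hi)
    (hb : lo ≤ b ∧ (b : EReal) ≤ hi) (h0 : 0 ≤ t) (h1 : t ≤ 1) :
    lo ≤ ((a + t * (b - a) : ℝ) : EReal) ∧ ((a + t * (b - a) : ℝ) : EReal) ≤ hi := by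
  rcases le_total a b with hab | hab
  · have h2 : 0 ≤ t * (b - a) := mul_nonneg h0 (by linarith)
    have h3 : t * (b - a) ≤ 1 * (b - a) := mul_le_mul_of_nonneg_right h1 (by linarith)
    exact ⟨ha.1.trans (EReal.coe_le_coe_iff.2 (by linarith)),
      (EReal.coe_le_coe_iff.2 (by linarith)).trans hb.2⟩
  · have h2 : 0 ≤ t * (a - b) := mul_nonneg h0 (by linarith)
    have h3 : t * (a - b) ≤ 1 * (a - b) := mul_le_mul_of_nonneg_right h1 (by linarith)
    exact ⟨hb.1.trans (EReal.coe_le_coe_iff.2 (by linarith)),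
      (EReal.coe_le_coe_iff.2 (by linarith)).trans ha.2⟩

theorem allowed_segment {D D' : Matrix (Fin n) (Fin n) ℝ} (hD : D ∈ S.allowed)
    (hD' : D' ∈ S.allowed) {t : ℝ} (h0 : 0 ≤ t) (h1 : t ≤ 1) : D + t • (D' - D) ∈ S.allowed := by
  refine ⟨fun e he => by simp [hD.1 e he, hD'.1 e he], fun e he => ?_⟩
  simpa using ereal_between_convex (hD.2 e he) (hD'.2 e he) h0 h1

theorem feasible_segment {D D' : Matrix (Fin n) (Fin n) ℝ} (hD : D ∈ feasible S ε)
    (hD' : D' ∈ feasible S ε) {t : ℝ} (h0 : 0 ≤ t) (h1 : t ≤ 1) :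
    D + t • (D' - D) ∈ feasible S ε := by
  refine ⟨allowed_segment hD.1 hD'.1 h0 h1, ?_⟩
  have : D + t • (D' - D) = (1 - t) • D + t • D' := by
    ext i j; simp; ring
  rw [this]
  refine (frobNorm_add_le _ _).trans ?_
  rw [frobNorm_smul, frobNorm_smul, abs_of_nonneg h0, abs_of_nonneg (by linarith)]
  nlinarith [mul_le_mul_of_nonneg_left hD.2 (sub_nonneg.2 h1), mul_le_mul_of_nonneg_left hD'.2 h0]

theorem isCompact_feasible : IsCompact (feasible S ε) := by
  have hK : IsCompact (Set.pi Set.univ fun _ : Fin n =>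
      Set.pi Set.univ fun _ : Fin n => Set.Icc (-ε) ε) :=
    isCompact_univ_pi fun _ => isCompact_univ_pi fun _ => isCompact_Icc
  refine IsCompact.of_isClosed_subset (s := (Set.pi Set.univ fun _ : Fin n =>
      Set.pi Set.univ fun _ : Fin n => Set.Icc (-ε) ε : Set (Matrix (Fin n) (Fin n) ℝ))) hK ?_ ?_
  · have hc : ∀ e : Fin n × Fin n,
        Continuous fun D : Matrix (Fin n) (Fin n) ℝ => D e.1 e.2 := fun e => by fun_prop
    have hc' : ∀ e : Fin n × Fin n,
        Continuous fun D : Matrix (Fin n) (Fin n) ℝ => ((D e.1 e.2 : ℝ) : EReal) :=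
      fun e => continuous_coe_real_ereal.comp (hc e)
    have h1 : IsClosed {D : Matrix (Fin n) (Fin n) ℝ | ∀ e, e ∉ S.edges → D e.1 e.2 = 0} := by
      simp only [Set.ofPred_forall]
      exact isClosed_iInter fun e => isClosed_iInter fun _ => isClosed_eq (hc e) continuous_const
    have h2 : IsClosed {D : Matrix (Fin n) (Fin n) ℝ | ∀ e ∈ S.edges,
        S.lo e ≤ (D e.1 e.2 : EReal) ∧ (D e.1 e.2 : EReal) ≤ S.hi e} := by
      simp only [Set.ofPred_forall]
      exact isClosed_iInter fun e => isClosed_iInter fun _ =>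
        (isClosed_le continuous_const (hc' e)).inter (isClosed_le (hc' e) continuous_const)
    have h3 : IsClosed {D : Matrix (Fin n) (Fin n) ℝ | frobNorm D ≤ ε} := by
      refine isClosed_le ?_ continuous_const
      unfold frobNorm
      fun_prop
    exact (h1.inter h2).inter h3
  · intro D hD i _ j _
    exact abs_le.1 ((abs_apply_le_frobNorm D i j).trans hD.2)

theorem exists_isOptimizer (hε : 0 ≤ ε) (M : Matrix (Fin n) (Fin n) ℝ) :
    ∃ D, IsOptimizer S ε M D := by
  have hc : Continuous fun D : Matrix (Fin n) (Fin n) ℝ => matInner D M := by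
    simp only [matInner_eq_sum]
    fun_prop
  obtain ⟨D, hD, h⟩ := isCompact_feasible.exists_isMaxOn ⟨0, zero_mem_feasible (S := S) hε⟩
    hc.continuousOn
  exact ⟨D, hD, fun D' hD' => h hD'⟩

/-! ### Multipliers -/

/-- `θ` is a multiplier for `D`: `D` has full energy and is the projection of `θ M` onto `H`. -/
structure IsMultiplier (S : PertStructure n) (ε : ℝ) (M D : Matrix (Fin n) (Fin n) ℝ) (θ : ℝ) :
    Prop where
  pos : 0 < θ
  allowed : D ∈ S.allowed
  norm_eq : frobNorm D = ε
  proj : ∀ D' ∈ S.allowed, matInner (θ • M - D) (D' - D) ≤ 0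

theorem IsMultiplier.feasible {θ : ℝ} (h : IsMultiplier S ε M D θ) : D ∈ feasible S ε :=
  ⟨h.allowed, h.norm_eq.le⟩

/-- Quadratic growth of the linear objective: `‖D'‖ ≤ ‖D‖` gives `‖D' - D‖² ≤ 2⟨D, D - D'⟩`, and the
variational inequality of the projection replaces `D` by `θ M` in the inner product. -/
theorem IsMultiplier.growth {θ : ℝ} (h : IsMultiplier S ε M D θ) {D' : Matrix (Fin n) (Fin n) ℝ}
    (hD' : D' ∈ StructuredPseudospectrum.feasible S ε) :
    frobNorm (D' - D) ^ 2 ≤ 2 * θ * matInner (D - D') M := by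
  have h1 := h.proj D' hD'.1
  have h2 : frobNorm D' ^ 2 ≤ frobNorm D ^ 2 :=
    pow_le_pow_left₀ (frobNorm_nonneg _) (hD'.2.trans h.norm_eq.ge) 2
  rw [frobNorm_sub_sq]
  simp only [matInner_sub_left, matInner_sub_right, matInner_smul_left, matInner_self] at h1 ⊢
  rw [matInner_comm D' D, matInner_comm D M, matInner_comm D' M]
  linarith

theorem IsMultiplier.isOptimizer {θ : ℝ} (h : IsMultiplier S ε M D θ) : IsOptimizer S ε M D := by
  refine ⟨h.feasible, fun D' hD' => ?_⟩
  have h1 := (sq_nonneg _).trans (h.growth hD')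
  rw [matInner_sub_left] at h1
  have := (mul_nonneg_iff_of_pos_left (mul_pos two_pos h.pos)).1 h1
  linarith

/-- Optimality of `D'` for `M'` bounds the objective gap in `IsMultiplier.growth` by `⟨D' - D, M' -
M⟩`; Cauchy–Schwarz and cancelling one factor finish. No nearness of `M'` to `M` is needed. -/
theorem IsMultiplier.dist_le {θ : ℝ} (h : IsMultiplier S ε M D θ)
    {M' D' : Matrix (Fin n) (Fin n) ℝ} (hD' : IsOptimizer S ε M' D') :
    frobNorm (D' - D) ≤ 2 * θ * frobNorm (M' - M) := by
  have h1 := h.growth hD'.1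
  have h2 := hD'.2 D h.feasible
  have h3 := matInner_le (D' - D) (M' - M)
  simp only [matInner_sub_left, matInner_sub_right] at h1 h3
  have h4 : frobNorm (D' - D) ^ 2 ≤ 2 * θ * (frobNorm (D' - D) * frobNorm (M' - M)) :=
    h1.trans (mul_le_mul_of_nonneg_left (by linarith) (mul_pos two_pos h.pos).le)
  rcases (frobNorm_nonneg (D' - D)).eq_or_lt with h0 | h0
  · rw [← h0]; exact mul_nonneg (mul_pos two_pos h.pos).le (frobNorm_nonneg _)
  · nlinarith

/-- Testing the projection inequality at `0` gives `ε² ≤ θ⟨M, D⟩ ≤ θ ε`. Needed to turn `θ ≤ c ε`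
into `1 ≤ c`. -/
theorem IsMultiplier.eps_le {θ : ℝ} (h : IsMultiplier S ε M D θ) (hε : 0 < ε)
    (hM : frobNorm M ≤ 1) : ε ≤ θ := by
  have h1 := h.proj 0 zero_mem_allowed
  have h2 := matInner_le M D
  simp only [zero_sub, matInner_sub_left, matInner_smul_left] at h1
  rw [← sub_nonpos, ← zero_sub, matInner_sub_right, matInner_sub_right, matInner_self] at h1
  simp only [h.norm_eq] at h1 h2
  have h3 : ∀ N : Matrix (Fin n) (Fin n) ℝ, matInner N 0 = 0 := fun N => by
    simp [matInner_eq_sum]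
  rw [h3, h3] at h1
  have h4 := mul_le_mul_of_nonneg_left h2 h.pos.le
  have h5 : frobNorm M * ε ≤ 1 * ε := mul_le_mul_of_nonneg_right hM hε.le
  have h6 := mul_le_mul_of_nonneg_left h5 h.pos.le
  nlinarith

/-- `H` is a product of intervals, so the projection inequality can be tested one entry at a time;
the complementary slackness rules that follow are its consequences. -/
theorem IsMultiplier.entry {θ : ℝ} (h : IsMultiplier S ε M D θ) {e : Fin n × Fin n}
    (he : e ∈ S.edges) {v : ℝ} (hl : S.lo e ≤ v) (hu : (v : EReal) ≤ S.hi e) :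
    (θ * M e.1 e.2 - D e.1 e.2) * (v - D e.1 e.2) ≤ 0 := by
  have hall : D + (v - D e.1 e.2) • unit e ∈ S.allowed := by
    refine ⟨fun f hf => ?_, fun f hf => ?_⟩
    · have : f ≠ e := fun h => hf (h ▸ he)
      simp [unit_apply, this, h.allowed.1 f hf]
    · by_cases hfe : f = e
      · subst hfe; simp [unit_apply, hl, hu]
      · simpa [unit_apply, hfe] using h.allowed.2 f hf
  have := h.proj _ hall
  rw [add_sub_cancel_left, matInner_comm, matInner_smul_left, matInner_comm, matInner_unit] at this
  simpa [mul_comm] using this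

theorem IsMultiplier.le_of_lt_hi {θ : ℝ} (h : IsMultiplier S ε M D θ) {e : Fin n × Fin n}
    (he : e ∈ S.edges) (hlt : (D e.1 e.2 : EReal) < S.hi e) : θ * M e.1 e.2 ≤ D e.1 e.2 := by
  obtain ⟨v, h1, h2⟩ := EReal.lt_iff_exists_real_btwn.1 hlt
  have h3 := h.entry he ((h.allowed.2 e he).1.trans h1.le) h2.le
  have h4 : 0 < v - D e.1 e.2 := sub_pos.2 (EReal.coe_lt_coe_iff.1 h1)
  nlinarith

theorem IsMultiplier.ge_of_lo_lt {θ : ℝ} (h : IsMultiplier S ε M D θ) {e : Fin n × Fin n}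
    (he : e ∈ S.edges) (hlt : S.lo e < (D e.1 e.2 : EReal)) : D e.1 e.2 ≤ θ * M e.1 e.2 := by
  obtain ⟨v, h1, h2⟩ := EReal.lt_iff_exists_real_btwn.1 hlt
  have h3 := h.entry he h1.le (h2.le.trans (h.allowed.2 e he).2)
  have h4 : 0 < D e.1 e.2 - v := sub_pos.2 (EReal.coe_lt_coe_iff.1 h2)
  nlinarith

theorem IsMultiplier.eq_of_unsaturated {θ : ℝ} (h : IsMultiplier S ε M D θ) {e : Fin n × Fin n}
    (he : e ∈ S.edges) (hl : S.lo e < (D e.1 e.2 : EReal)) (hu : (D e.1 e.2 : EReal) < S.hi e) :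
    D e.1 e.2 = θ * M e.1 e.2 :=
  le_antisymm (h.ge_of_lo_lt he hl) (h.le_of_lt_hi he hu)

theorem IsMultiplier.sq_le {θ : ℝ} (h : IsMultiplier S ε M D θ) {e : Fin n × Fin n}
    (he : e ∈ S.edges) : D e.1 e.2 ^ 2 ≤ θ * M e.1 e.2 * D e.1 e.2 := by
  have := h.entry he (v := 0) (by simpa using S.lo_nonpos e he) (by simpa using S.hi_nonneg e he)
  nlinarith

/-- Moving the unsaturated entry `e₀` and moving along a segment of `H` at the same time. -/
theorem eventually_mem_allowed (hD : D ∈ S.allowed) {D' : Matrix (Fin n) (Fin n) ℝ}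
    (hD' : D' ∈ S.allowed) {e₀ : Fin n × Fin n} (he₀ : e₀ ∈ S.edges)
    (hl : S.lo e₀ < (D e₀.1 e₀.2 : EReal)) (hu : (D e₀.1 e₀.2 : EReal) < S.hi e₀) (κ : ℝ) :
    ∀ᶠ t in 𝓝[>] (0 : ℝ), D + t • (D' - D + κ • unit e₀) ∈ S.allowed := by
  have hc : Tendsto (fun t : ℝ =>
      ((D e₀.1 e₀.2 + t * (D' e₀.1 e₀.2 - D e₀.1 e₀.2 + κ) : ℝ) : EReal)) (𝓝[>] 0)
      (𝓝 (D e₀.1 e₀.2 : EReal)) := by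
    have h : Continuous fun t : ℝ =>
      ((D e₀.1 e₀.2 + t * (D' e₀.1 e₀.2 - D e₀.1 e₀.2 + κ) : ℝ) : EReal) :=
      continuous_coe_real_ereal.comp (by fun_prop)
    have := h.tendsto 0
    simp only [zero_mul, add_zero] at this
    exact this.mono_left nhdsWithin_le_nhds
  have h1 : ∀ᶠ t in 𝓝[>] (0 : ℝ), t < 1 :=
    nhdsWithin_le_nhds (eventually_lt_nhds one_pos)
  filter_upwards [hc.eventually (lt_mem_nhds hl), hc.eventually (gt_mem_nhds hu), h1,
    self_mem_nhdsWithin] with t ha hb h1 h0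
  refine ⟨fun f hf => ?_, fun f hf => ?_⟩
  · have : f ≠ e₀ := fun h => hf (h ▸ he₀)
    simp [unit_apply, this, hD.1 f hf, hD'.1 f hf]
  · by_cases hfe : f = e₀
    · subst hfe
      have h2 : (D + t • (D' - D + κ • unit f)) f.1 f.2 =
          D f.1 f.2 + t * (D' f.1 f.2 - D f.1 f.2 + κ) := by
        simp only [Matrix.add_apply, Matrix.smul_apply, Matrix.sub_apply, unit_apply_self,
          smul_eq_mul]
        ring
      rw [h2]
      exact ⟨ha.le, hb.le⟩
    · simpa [unit_apply, hfe] using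
        ereal_between_convex (hD.2 f hf) (hD'.2 f hf) (le_of_lt h0) h1.le

/-- The unsaturated entry `e₀` can move both ways, so the term `κ • unit e₀` can be used to pay for
the energy of a move towards `D'`. The direction is feasible for small times when there is slack in
the norm or when the norm decreases to first order, and the objective cannot increase along it. -/
theorem IsOptimizer.first_order (hD : IsOptimizer S ε M D) {D' : Matrix (Fin n) (Fin n) ℝ}
    (hD' : D' ∈ S.allowed) {e₀ : Fin n × Fin n} (he₀ : e₀ ∈ S.edges)
    (hl : S.lo e₀ < (D e₀.1 e₀.2 : EReal)) (hu : (D e₀.1 e₀.2 : EReal) < S.hi e₀) (κ : ℝ)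
    (hdec : frobNorm D < ε ∨ matInner D (D' - D) + κ * D e₀.1 e₀.2 < 0) :
    matInner (D' - D) M + κ * M e₀.1 e₀.2 ≤ 0 := by
  set W := D' - D + κ • unit e₀ with hW
  have hWM : matInner W M = matInner (D' - D) M + κ * M e₀.1 e₀.2 := by
    rw [hW, matInner_add_left, matInner_smul_left, matInner_comm (unit e₀), matInner_unit]
  have hWD : matInner D W = matInner D (D' - D) + κ * D e₀.1 e₀.2 := by
    rw [hW, matInner_comm, matInner_add_left, matInner_smul_left, matInner_comm (unit e₀),
      matInner_unit, matInner_comm D]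
  rw [← hWD] at hdec
  rw [← hWM]
  have hε : 0 ≤ ε := (frobNorm_nonneg D).trans hD.1.2
  have hnorm : ∀ᶠ t in 𝓝[>] (0 : ℝ), frobNorm (D + t • W) ≤ ε := by
    rcases hdec with h | h
    · have hc : Tendsto (fun t : ℝ => frobNorm D + t * frobNorm W) (𝓝[>] 0) (𝓝 (frobNorm D)) := by
        have : Continuous fun t : ℝ => frobNorm D + t * frobNorm W := by fun_prop
        have := this.tendsto 0
        simp only [zero_mul, add_zero] at this
        exact this.mono_left nhdsWithin_le_nhds
      filter_upwards [hc.eventually (gt_mem_nhds h), self_mem_nhdsWithin] with t ht h0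
      refine (frobNorm_add_le _ _).trans ?_
      rw [frobNorm_smul, abs_of_pos h0]
      exact ht.le
    · have hc : Tendsto (fun t : ℝ => 2 * matInner D W + t * frobNorm W ^ 2) (𝓝[>] 0)
          (𝓝 (2 * matInner D W)) := by
        have : Continuous fun t : ℝ => 2 * matInner D W + t * frobNorm W ^ 2 := by fun_prop
        have := this.tendsto 0
        simp only [zero_mul, add_zero] at this
        exact this.mono_left nhdsWithin_le_nhds
      filter_upwards [hc.eventually (gt_mem_nhds (show 2 * matInner D W < 0 by linarith)),
        self_mem_nhdsWithin] with t ht h0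
      have h0' : (0 : ℝ) < t := h0
      refine (abs_le_of_sq_le_sq' ?_ hε).2
      have h2 : frobNorm D ^ 2 ≤ ε ^ 2 := pow_le_pow_left₀ (frobNorm_nonneg _) hD.1.2 2
      rw [frobNorm_add_sq, frobNorm_smul, matInner_comm, matInner_smul_left, mul_pow, sq_abs,
        matInner_comm W]
      nlinarith
  obtain ⟨t, h1, h2, h0⟩ := ((eventually_mem_allowed hD.1.1 hD' he₀ hl hu κ).and
    (hnorm.and self_mem_nhdsWithin)).exists
  have h3 := hD.2 _ ⟨h1, h2⟩
  rw [matInner_add_left, matInner_smul_left] at h3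
  have h0' : (0 : ℝ) < t := h0
  by_contra hpos
  push Not at hpos
  nlinarith [mul_pos h0' hpos]

theorem IsOptimizer.exists_multiplier (hε : 0 < ε) (hD : IsOptimizer S ε M D)
    (hs : NonSaturated S M D) : ∃ θ, IsMultiplier S ε M D θ := by
  obtain ⟨e₀, he₀, hl, hu, hm⟩ := hs
  have key := fun (D' : Matrix (Fin n) (Fin n) ℝ) (hD' : D' ∈ S.allowed) (κ : ℝ) =>
    hD.first_order hD' he₀ hl hu κ
  set m := M e₀.1 e₀.2 with hmdef
  set d := D e₀.1 e₀.2 with hddef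
  have hz : ∀ N : Matrix (Fin n) (Fin n) ℝ, matInner N 0 = 0 := fun N => by
    simp [matInner_eq_sum]
  have hz' : ∀ N : Matrix (Fin n) (Fin n) ℝ, matInner 0 N = 0 := fun N => by
    simp [matInner_eq_sum]
  have hnorm : frobNorm D = ε := by
    by_contra hne
    -- With slack in the norm, `e₀` alone could be moved in the direction of `m`.
    have h := key D hD.1.1 m (Or.inl (lt_of_le_of_ne hD.1.2 hne))
    rw [sub_self, hz'] at h
    nlinarith [mul_self_pos.2 hm]
  have hd : d ≠ 0 := by
    intro h0
    -- If `d = 0`, moving towards `0` lowers the energy to first order while `e₀` moves free of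
    -- charge; this `κ` makes the objective gain equal to `1`.
    have h := key 0 zero_mem_allowed ((matInner D M + 1) / m) (Or.inr (by
      rw [h0, zero_sub, ← zero_sub, matInner_sub_right, hz, matInner_self, hnorm]
      nlinarith))
    rw [zero_sub, ← zero_sub, matInner_sub_left, hz', div_mul_cancel₀ _ hm] at h
    linarith
  have hdm : 0 < d * m := by
    have h := key D hD.1.1 (-d) (Or.inr (by
      rw [sub_self, hz]; nlinarith [mul_self_pos.2 hd]))
    rw [sub_self, hz'] at h
    exact lt_of_le_of_ne (by linarith) (mul_ne_zero hd hm).symm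
  have hθ : 0 < d / m := by
    rw [show d / m = d * m / m ^ 2 by field_simp]
    exact div_pos hdm (by positivity)
  -- The multiplier is forced by `d = θ m` at the unsaturated edge.
  refine ⟨d / m, hθ, hD.1.1, hnorm, fun D' hD' => ?_⟩
  rw [matInner_sub_left, matInner_smul_left, sub_nonpos]
  refine le_of_forall_pos_le_add fun η hη => ?_
  -- This `κ` makes the first-order change of the energy equal to `-η`, just negative; `η` is then
  -- sent to zero.
  have h := key D' hD' (-(matInner D (D' - D) + η) / d) (Or.inr (by
    rw [div_mul_cancel₀ _ hd]; linarith))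
  rw [matInner_comm (D' - D)] at h
  have h2 := mul_le_mul_of_nonneg_left h hθ.le
  have h3 : d / m * (matInner M (D' - D) + -(matInner D (D' - D) + η) / d * m) =
      d / m * matInner M (D' - D) - (matInner D (D' - D) + η) := by
    field_simp
    ring
  rw [h3, mul_zero] at h2
  linarith

end StructuredPseudospectrum

namespace StructuredPseudospectrum

open Filter Topology

variable {n : ℕ} {S : PertStructure n} {ε : ℝ} {M D : Matrix (Fin n) (Fin n) ℝ}

/-! ### Correctness of the index-set algorithm -/

/-- The saturation sets found so far contain only edges that are saturated in `D`. -/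
structure SaturationInvariant (S : PertStructure n) (D : Matrix (Fin n) (Fin n) ℝ)
    (Su Sl : Finset (Fin n × Fin n)) : Prop where
  subset : Su ∪ Sl ⊆ S.edges
  disjoint : Disjoint Su Sl
  hi_eq : ∀ e ∈ Su, S.hi e = (D e.1 e.2 : EReal)
  lo_eq : ∀ e ∈ Sl, S.lo e = (D e.1 e.2 : EReal)

theorem sum_edges_sq (hD : D ∈ S.allowed) : ∑ e ∈ S.edges, D e.1 e.2 ^ 2 = frobNorm D ^ 2 := by
  rw [frobNorm_sq]
  refine Finset.sum_subset (Finset.subset_univ _) fun e _ he => ?_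
  rw [hD.1 e he]; simp

theorem SaturationInvariant.notMem {Su Sl : Finset (Fin n × Fin n)}
    (hI : SaturationInvariant S D Su Sl) {e₀ : Fin n × Fin n}
    (hl : S.lo e₀ < (D e₀.1 e₀.2 : EReal)) (hu : (D e₀.1 e₀.2 : EReal) < S.hi e₀) :
    e₀ ∉ Su ∪ Sl := by
  intro h
  rcases Finset.mem_union.1 h with h | h
  · exact hu.ne (hI.hi_eq _ h).symm
  · exact hl.ne (hI.lo_eq _ h)

/-- The numerator in `theta` is the energy that `D` itself has on the remaining edges, because `D`
has full norm `ε`. -/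
theorem SaturationInvariant.energy {θ : ℝ} (h : IsMultiplier S ε M D θ)
    {Su Sl : Finset (Fin n × Fin n)} (hI : SaturationInvariant S D Su Sl) :
    ε ^ 2 - ∑ e ∈ Su, (S.hi e).toReal ^ 2 - ∑ e ∈ Sl, (S.lo e).toReal ^ 2 =
      ∑ e ∈ S.edges \ (Su ∪ Sl), D e.1 e.2 ^ 2 := by
  have h1 : ∑ e ∈ Su, (S.hi e).toReal ^ 2 = ∑ e ∈ Su, D e.1 e.2 ^ 2 :=
    Finset.sum_congr rfl fun e he => by rw [hI.hi_eq e he, EReal.toReal_coe]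
  have h2 : ∑ e ∈ Sl, (S.lo e).toReal ^ 2 = ∑ e ∈ Sl, D e.1 e.2 ^ 2 :=
    Finset.sum_congr rfl fun e he => by rw [hI.lo_eq e he, EReal.toReal_coe]
  have h3 := sum_edges_sq h.allowed
  rw [h.norm_eq, ← Finset.sum_sdiff hI.subset, Finset.sum_union hI.disjoint] at h3
  rw [h1, h2]
  linarith

/-- The ratio stays below the true multiplier because projecting `θ M` onto intervals containing `0`
shrinks entries: `D_e² ≤ θ² M_e²`. The edge `e₀` is never saturated and keeps both sums positive. -/
theorem SaturationInvariant.theta_spec {θ : ℝ} (h : IsMultiplier S ε M D θ)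
    {Su Sl : Finset (Fin n × Fin n)} (hI : SaturationInvariant S D Su Sl) {e₀ : Fin n × Fin n}
    (he₀ : e₀ ∈ S.edges) (hl : S.lo e₀ < (D e₀.1 e₀.2 : EReal))
    (hu : (D e₀.1 e₀.2 : EReal) < S.hi e₀) (hm : M e₀.1 e₀.2 ≠ 0) :
    0 < theta S ε M Su Sl ∧ theta S ε M Su Sl ≤ θ ∧
      ∑ e ∈ S.edges \ (Su ∪ Sl), (theta S ε M Su Sl * M e.1 e.2) ^ 2 =
        ∑ e ∈ S.edges \ (Su ∪ Sl), D e.1 e.2 ^ 2 := by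
  set R := S.edges \ (Su ∪ Sl) with hR
  have heR : e₀ ∈ R := Finset.mem_sdiff.2 ⟨he₀, hI.notMem hl hu⟩
  have hd : D e₀.1 e₀.2 ≠ 0 := by
    rw [h.eq_of_unsaturated he₀ hl hu]; exact mul_ne_zero h.pos.ne' hm
  have hMpos : 0 < ∑ e ∈ R, M e.1 e.2 ^ 2 :=
    Finset.sum_pos' (fun e _ => sq_nonneg _) ⟨e₀, heR, by positivity⟩
  have hDpos : 0 < ∑ e ∈ R, D e.1 e.2 ^ 2 :=
    Finset.sum_pos' (fun e _ => sq_nonneg _) ⟨e₀, heR, by positivity⟩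
  have hle : ∑ e ∈ R, D e.1 e.2 ^ 2 ≤ θ ^ 2 * ∑ e ∈ R, M e.1 e.2 ^ 2 := by
    rw [Finset.mul_sum]
    refine Finset.sum_le_sum fun e he => ?_
    have h1 := h.sq_le (Finset.mem_sdiff.1 he).1
    nlinarith [sq_nonneg (D e.1 e.2 - θ * M e.1 e.2)]
  have hθ : theta S ε M Su Sl =
      Real.sqrt ((∑ e ∈ R, D e.1 e.2 ^ 2) / ∑ e ∈ R, M e.1 e.2 ^ 2) := by
    rw [theta, hI.energy h]
  have hsq : theta S ε M Su Sl ^ 2 = (∑ e ∈ R, D e.1 e.2 ^ 2) / ∑ e ∈ R, M e.1 e.2 ^ 2 := by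
    rw [hθ, Real.sq_sqrt (div_pos hDpos hMpos).le]
  refine ⟨hθ ▸ Real.sqrt_pos.2 (div_pos hDpos hMpos), ?_, ?_⟩
  · rw [hθ]
    exact Real.sqrt_le_iff.2 ⟨h.pos.le, (div_le_iff₀ hMpos).2 hle⟩
  · simp only [mul_pow]
    rw [← Finset.mul_sum, hsq, div_mul_cancel₀ _ hMpos.ne']

/-- An underestimate `t ≤ θ` cannot saturate an edge wrongly: if `D_e` were below its bound, then `θ
M_e ≤ D_e < t M_e`, although `M_e ≥ 0`. -/
theorem saturated_upper {θ t : ℝ} (h : IsMultiplier S ε M D θ) (ht : 0 < t) (htθ : t ≤ θ)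
    {e : Fin n × Fin n} (he : e ∈ S.edges) (hs : S.hi e ≤ ((M e.1 e.2 * t : ℝ) : EReal)) :
    S.hi e = (D e.1 e.2 : EReal) := by
  by_contra hne
  have hlt := lt_of_le_of_ne (h.allowed.2 e he).2 (Ne.symm hne)
  have h1 := h.le_of_lt_hi he hlt
  have h2 : (0 : ℝ) ≤ M e.1 e.2 * t := EReal.coe_le_coe_iff.1 ((S.hi_nonneg e he).trans hs)
  have h3 : D e.1 e.2 < M e.1 e.2 * t := EReal.coe_lt_coe_iff.1 (hlt.trans_le hs)
  have h4 : 0 ≤ M e.1 e.2 := nonneg_of_mul_nonneg_left h2 ht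
  nlinarith

theorem saturated_lower {θ t : ℝ} (h : IsMultiplier S ε M D θ) (ht : 0 < t) (htθ : t ≤ θ)
    {e : Fin n × Fin n} (he : e ∈ S.edges) (hs : ((M e.1 e.2 * t : ℝ) : EReal) ≤ S.lo e) :
    S.lo e = (D e.1 e.2 : EReal) := by
  by_contra hne
  have hlt := lt_of_le_of_ne (h.allowed.2 e he).1 hne
  have h1 := h.ge_of_lo_lt he hlt
  have h2 : M e.1 e.2 * t ≤ (0 : ℝ) := EReal.coe_le_coe_iff.1 (hs.trans (S.lo_nonpos e he))
  have h3 : M e.1 e.2 * t < D e.1 e.2 := EReal.coe_lt_coe_iff.1 (hs.trans_lt hlt)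
  have h4 : M e.1 e.2 ≤ 0 := by
    by_contra hp
    push Not at hp
    nlinarith [mul_pos hp ht]
  nlinarith

/-- If `t M` respects all remaining bounds, then `|t M_e| ≤ |D_e|` on every remaining edge. The sums
of squares agree, so all these are equalities, and `IsMultiplier.sq_le` fixes the signs. -/
theorem SaturationInvariant.assemble_eq {θ t : ℝ} (h : IsMultiplier S ε M D θ)
    {Su Sl : Finset (Fin n × Fin n)} (hI : SaturationInvariant S D Su Sl) (ht : 0 < t)
    (htθ : t ≤ θ)
    (hsum : ∑ e ∈ S.edges \ (Su ∪ Sl), (t * M e.1 e.2) ^ 2 =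
      ∑ e ∈ S.edges \ (Su ∪ Sl), D e.1 e.2 ^ 2)
    (hup : ∀ e ∈ S.edges \ (Su ∪ Sl), ((M e.1 e.2 * t : ℝ) : EReal) < S.hi e)
    (hlow : ∀ e ∈ S.edges \ (Su ∪ Sl), S.lo e < ((M e.1 e.2 * t : ℝ) : EReal)) :
    assemble S M Su Sl t = D := by
  have hle : ∀ e ∈ S.edges \ (Su ∪ Sl), (t * M e.1 e.2) ^ 2 ≤ D e.1 e.2 ^ 2 := by
    intro e heR
    have he := (Finset.mem_sdiff.1 heR).1
    rcases le_total 0 (M e.1 e.2) with hm | hm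
    · have h0 : 0 ≤ t * M e.1 e.2 := mul_nonneg ht.le hm
      refine pow_le_pow_left₀ h0 ?_ 2
      rcases (h.allowed.2 e he).2.eq_or_lt with h1 | h1
      · have := hup e heR
        rw [← h1, EReal.coe_lt_coe_iff] at this
        linarith
      · by_cases h2 : S.lo e < (D e.1 e.2 : EReal)
        · rw [h.eq_of_unsaturated he h2 h1]
          exact mul_le_mul_of_nonneg_right htθ hm
        · have h3 := h.le_of_lt_hi he h1
          exact (mul_le_mul_of_nonneg_right htθ hm).trans h3
    · have h0 : t * M e.1 e.2 ≤ 0 := mul_nonpos_of_nonneg_of_nonpos ht.le hm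
      rw [← neg_sq, ← neg_sq (D e.1 e.2)]
      refine pow_le_pow_left₀ (neg_nonneg.2 h0) (neg_le_neg ?_) 2
      rcases (h.allowed.2 e he).1.eq_or_lt with h1 | h1
      · have := hlow e heR
        rw [h1, EReal.coe_lt_coe_iff] at this
        linarith
      · exact (h.ge_of_lo_lt he h1).trans (mul_le_mul_of_nonpos_right htθ hm)
  have heq := (Finset.sum_eq_sum_iff_of_le hle).1 hsum
  have hrest : ∀ e ∈ S.edges \ (Su ∪ Sl), M e.1 e.2 * t = D e.1 e.2 := by
    intro e heR
    have h1 := h.sq_le (Finset.mem_sdiff.1 heR).1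
    rcases sq_eq_sq_iff_eq_or_eq_neg.1 (heq e heR) with h2 | h2
    · linarith
    · have h3 : D e.1 e.2 = -(t * M e.1 e.2) := by linarith
      rw [h3] at h1
      have h4 : 0 ≤ t * θ * M e.1 e.2 ^ 2 :=
        mul_nonneg (mul_nonneg ht.le h.pos.le) (sq_nonneg _)
      have h5 : t * M e.1 e.2 = 0 := by
        refine pow_eq_zero_iff two_ne_zero |>.1 (le_antisymm ?_ (sq_nonneg _))
        nlinarith
      linarith
  ext i j
  unfold assemble
  split_ifs with h1 h2 h3
  · rw [hI.hi_eq _ h1, EReal.toReal_coe]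
  · rw [hI.lo_eq _ h2, EReal.toReal_coe]
  · exact hrest (i, j) (Finset.mem_sdiff.2 ⟨h3, by simp [h1, h2]⟩)
  · exact (h.allowed.1 (i, j) h3).symm

theorem SaturationInvariant.step {θ t : ℝ} (h : IsMultiplier S ε M D θ)
    {Su Sl : Finset (Fin n × Fin n)} (hI : SaturationInvariant S D Su Sl) (ht : 0 < t)
    (htθ : t ≤ θ) :
    SaturationInvariant S D (Su ∪ newUpper S M Su Sl t) (Sl ∪ newLower S M Su Sl t) := by
  classical
  have hu : ∀ e ∈ newUpper S M Su Sl t, e ∈ S.edges ∧ e ∉ Su ∪ Sl ∧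
      S.hi e ≤ ((M e.1 e.2 * t : ℝ) : EReal) := fun e he => by
    simpa only [newUpper, Finset.mem_filter, Finset.mem_sdiff, and_assoc] using he
  have hl : ∀ e ∈ newLower S M Su Sl t, e ∈ S.edges ∧ e ∉ Su ∪ Sl ∧
      ¬ S.hi e ≤ ((M e.1 e.2 * t : ℝ) : EReal) ∧ ((M e.1 e.2 * t : ℝ) : EReal) ≤ S.lo e :=
    fun e he => by
    simpa only [newLower, Finset.mem_filter, Finset.mem_sdiff, and_assoc] using he
  refine ⟨?_, ?_, ?_, ?_⟩
  · intro e he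
    rcases Finset.mem_union.1 he with he | he <;> rcases Finset.mem_union.1 he with he | he
    · exact hI.subset (Finset.mem_union_left _ he)
    · exact (hu e he).1
    · exact hI.subset (Finset.mem_union_right _ he)
    · exact (hl e he).1
  · refine Finset.disjoint_left.2 fun e h1 h2 => ?_
    rcases Finset.mem_union.1 h1 with h1 | h1 <;> rcases Finset.mem_union.1 h2 with h2 | h2
    · exact Finset.disjoint_left.1 hI.disjoint h1 h2
    · exact (hl e h2).2.1 (Finset.mem_union_left _ h1)
    · exact (hu e h1).2.1 (Finset.mem_union_right _ h2)
    · exact (hl e h2).2.2.1 (hu e h1).2.2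
  · intro e he
    rcases Finset.mem_union.1 he with he | he
    · exact hI.hi_eq e he
    · exact saturated_upper h ht htθ (hu e he).1 (hu e he).2.2
  · intro e he
    rcases Finset.mem_union.1 he with he | he
    · exact hI.lo_eq e he
    · exact saturated_lower h ht htθ (hl e he).1 (hl e he).2.2.2

/-- The invariant survives each pass, `e₀` keeps the error branch from being reached, and the number
of remaining edges drops with each pass that does not stop. -/
theorem saturationLoop_eq {θ : ℝ} (h : IsMultiplier S ε M D θ) (hs : NonSaturated S M D) (k : ℕ) :
    ∀ Su Sl : Finset (Fin n × Fin n), SaturationInvariant S D Su Sl →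
      (S.edges \ (Su ∪ Sl)).card < k → ∃ t, saturationLoop S ε M k Su Sl = some (t, D) := by
  classical
  obtain ⟨e₀, he₀, hl, hu, hm⟩ := hs
  induction k with
  | zero => intro Su Sl _ hk; exact absurd hk (Nat.not_lt_zero _)
  | succ k ih =>
    intro Su Sl hI hk
    obtain ⟨ht, htθ, hsum⟩ := hI.theta_spec h he₀ hl hu hm
    have hne : Su ∪ Sl ≠ S.edges := fun heq => hI.notMem hl hu (heq ▸ he₀)
    rw [saturationLoop, if_neg hne]
    split_ifs with hnew
    · refine ⟨theta S ε M Su Sl, ?_⟩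
      have hup : ∀ e ∈ S.edges \ (Su ∪ Sl),
          ((M e.1 e.2 * theta S ε M Su Sl : ℝ) : EReal) < S.hi e := fun e he =>
        not_le.1 (Finset.filter_eq_empty_iff.1 hnew.1 he)
      have hlow : ∀ e ∈ S.edges \ (Su ∪ Sl),
          S.lo e < ((M e.1 e.2 * theta S ε M Su Sl : ℝ) : EReal) := fun e he =>
        not_le.1 fun hle => Finset.filter_eq_empty_iff.1 hnew.2 he ⟨not_le.2 (hup e he), hle⟩
      rw [hI.assemble_eq h ht htθ hsum hup hlow]
    · refine ih _ _ (hI.step h ht htθ) ?_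
      refine lt_of_lt_of_le (Finset.card_lt_card ?_) (Nat.lt_succ_iff.1 hk)
      refine Finset.ssubset_iff_of_subset ?_ |>.2 ?_
      · refine Finset.sdiff_subset_sdiff subset_rfl ?_
        exact Finset.union_subset_union Finset.subset_union_left Finset.subset_union_left
      · rcases not_and_or.1 hnew with hn | hn <;>
          obtain ⟨e, he⟩ := Finset.nonempty_iff_ne_empty.2 hn
        · exact ⟨e, (Finset.mem_filter.1 he).1, fun h' => (Finset.mem_sdiff.1 h').2
            (Finset.mem_union_left _ (Finset.mem_union_right _ he))⟩
        · exact ⟨e, (Finset.mem_filter.1 he).1, fun h' => (Finset.mem_sdiff.1 h').2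
            (Finset.mem_union_right _ (Finset.mem_union_right _ he))⟩

/-- The index-set algorithm returns the non-saturated optimizer of the linear problem. -/
theorem IsOptimizer.indexSetAlgorithm_eq (hε : 0 < ε) (hD : IsOptimizer S ε M D)
    (hs : NonSaturated S M D) : ∃ t, indexSetAlgorithm S ε M = some (t, D) := by
  obtain ⟨θ, hθ⟩ := hD.exists_multiplier hε hs
  exact saturationLoop_eq hθ hs _ ∅ ∅ ⟨by simp, by simp, by simp, by simp⟩ (by simp)

/-! ### Sensitivity of the linear problem -/

/-- Its second hypothesis on `M'`, `D'` has the form of `IsMultiplier.dist_le`: properties open in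
the pair pass to every `M'` near `M` together with each of its optimizers. -/
theorem exists_pair_ball {p : Matrix (Fin n) (Fin n) ℝ → Matrix (Fin n) (Fin n) ℝ → Prop}
    (h : ∀ᶠ q in 𝓝 M ×ˢ 𝓝 D, p q.1 q.2) {C : ℝ} (hC : 0 < C) :
    ∃ δ > 0, ∀ M' D', frobNorm (M' - M) ≤ δ → frobNorm (D' - D) ≤ C * frobNorm (M' - M) →
      p M' D' := by
  obtain ⟨pa, ha, pb, hb, hab⟩ := eventually_prod_iff.1 h
  obtain ⟨η₁, h1, hb1⟩ := exists_frobNorm_ball ha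
  obtain ⟨η₂, h2, hb2⟩ := exists_frobNorm_ball hb
  refine ⟨min (η₁ / 2) (η₂ / (2 * C)), by positivity, fun M' D' hM' hD' => ?_⟩
  refine hab (hb1 M' ?_) (hb2 D' ?_)
  · exact lt_of_le_of_lt (hM'.trans (min_le_left _ _)) (half_lt_self h1)
  · have h3 := mul_le_mul_of_nonneg_left (hM'.trans (min_le_right _ _)) hC.le
    have h4 : C * (η₂ / (2 * C)) = η₂ / 2 := by field_simp
    linarith

theorem IsMultiplier.isSensitivityConstant {θ : ℝ} (h : IsMultiplier S ε M D θ) (hε : 0 < ε) :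
    IsSensitivityConstant S ε M D (2 * θ / ε) := by
  -- The radius `1` is arbitrary, since the Lipschitz bound is global.
  refine ⟨div_pos (mul_pos two_pos h.pos) hε, 1, one_pos, fun M' _ _ D' hD' => ?_⟩
  rw [div_mul_cancel₀ _ hε.ne']
  exact h.dist_le hD'

theorem eventually_nonSaturated (hs : NonSaturated S M D) :
    ∀ᶠ q in 𝓝 M ×ˢ 𝓝 D, NonSaturated S q.1 q.2 := by
  obtain ⟨e, he, hl, hu, hm⟩ := hs
  have hM : Tendsto (fun q : Matrix (Fin n) (Fin n) ℝ × Matrix (Fin n) (Fin n) ℝ => q.1 e.1 e.2)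
      (𝓝 M ×ˢ 𝓝 D) (𝓝 (M e.1 e.2)) := by
    have : Continuous fun N : Matrix (Fin n) (Fin n) ℝ => N e.1 e.2 := by fun_prop
    exact (this.tendsto M).comp tendsto_fst
  have hD : Tendsto (fun q : Matrix (Fin n) (Fin n) ℝ × Matrix (Fin n) (Fin n) ℝ =>
      ((q.2 e.1 e.2 : ℝ) : EReal)) (𝓝 M ×ˢ 𝓝 D) (𝓝 (D e.1 e.2 : EReal)) := by
    have : Continuous fun N : Matrix (Fin n) (Fin n) ℝ => ((N e.1 e.2 : ℝ) : EReal) :=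
      continuous_coe_real_ereal.comp (by fun_prop)
    exact (this.tendsto D).comp tendsto_snd
  filter_upwards [hM.eventually_ne hm, hD.eventually (lt_mem_nhds hl),
    hD.eventually (gt_mem_nhds hu)] with q h1 h2 h3
  exact ⟨e, he, h2, h3, h1⟩

/-- Near `M` the index-set algorithm ends without error, with an optimizer. -/
theorem IsOptimizer.algorithm_near (hε : 0 < ε) (hD : IsOptimizer S ε M D)
    (hs : NonSaturated S M D) :
    ∃ δ > 0, ∀ M', frobNorm (M' - M) ≤ δ →
      ∃ t D', indexSetAlgorithm S ε M' = some (t, D') ∧ IsOptimizer S ε M' D' := by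
  obtain ⟨θ, hθ⟩ := hD.exists_multiplier hε hs
  obtain ⟨δ, hδ, h⟩ := exists_pair_ball (eventually_nonSaturated hs) (mul_pos two_pos hθ.pos)
  refine ⟨δ, hδ, fun M' hM' => ?_⟩
  obtain ⟨D', hD'⟩ := exists_isOptimizer (S := S) hε.le M'
  obtain ⟨t, ht⟩ := hD'.indexSetAlgorithm_eq hε (h M' D' hM' (hθ.dist_le hD'))
  exact ⟨t, D', ht, hD'⟩

/-- If some entry besides `e₀` is free to move, rotating it against the entry `e₀` shows that a
sensitivity constant is at least `θ / ε`. -/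
theorem IsMultiplier.le_of_movable {θ : ℝ} (h : IsMultiplier S ε M D θ)
    (hM : frobNorm M ≤ 1) {e₀ e : Fin n × Fin n} (he₀ : e₀ ∈ S.edges)
    (hl : S.lo e₀ < (D e₀.1 e₀.2 : EReal)) (hu : (D e₀.1 e₀.2 : EReal) < S.hi e₀)
    (hd : D e₀.1 e₀.2 ≠ 0) (he : e ∈ S.edges) (hne : e ≠ e₀) (hlt : S.lo e < S.hi e)
    (hmov : θ * M e.1 e.2 = D e.1 e.2) {c : ℝ} (hc : IsSensitivityConstant S ε M D c) :
    θ ≤ c * ε := by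
  obtain ⟨-, δ, hδ, hsens⟩ := hc
  have hθ := h.pos
  have hm₀ := h.eq_of_unsaturated he₀ hl hu
  obtain ⟨w, hw, hwd⟩ : ∃ w : ℝ, (S.lo e ≤ w ∧ (w : EReal) ≤ S.hi e) ∧ w ≠ D e.1 e.2 := by
    rcases (h.allowed.2 e he).1.eq_or_lt with h1 | h1
    · rw [h1] at hlt
      obtain ⟨w, h2, h3⟩ := EReal.lt_iff_exists_real_btwn.1 hlt
      exact ⟨w, ⟨h1.le.trans h2.le, h3.le⟩, (EReal.coe_lt_coe_iff.1 h2).ne'⟩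
    · obtain ⟨w, h2, h3⟩ := EReal.lt_iff_exists_real_btwn.1 h1
      exact ⟨w, ⟨h2.le, h3.le.trans (h.allowed.2 e he).2⟩, (EReal.coe_lt_coe_iff.1 h3).ne⟩
  set d := D e.1 e.2 with hddef
  set d₀ := D e₀.1 e₀.2 with hd₀def
  let v : ℝ → ℝ := fun t => d + t * (w - d)
  -- The `e₀` entry is chosen so that `v² + p² = d² + d₀²`: the pair of entries rotates, and `p`
  -- keeps the sign of `d₀`.
  let p : ℝ → ℝ := fun t => d₀ * Real.sqrt (1 + (d ^ 2 - v t ^ 2) / d₀ ^ 2)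
  let N : ℝ → Matrix (Fin n) (Fin n) ℝ := fun t => (v t - d) • unit e + (p t - d₀) • unit e₀
  have hv0 : v 0 = d := by simp [v]
  have hp0 : p 0 = d₀ := by simp [p, hv0]
  have hvc : Continuous v := by fun_prop
  have hpc : Continuous p := by fun_prop
  have hNsq : ∀ t, frobNorm (N t) ^ 2 = (v t - d) ^ 2 + (p t - d₀) ^ 2 := fun t => by
    rw [← matInner_self]
    simp only [N, matInner_add_left, matInner_smul_left]
    rw [matInner_comm (unit e), matInner_comm (unit e₀), matInner_unit, matInner_unit]
    simp [unit_apply, hne, hne.symm]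
    ring
  have hinner : ∀ (Q : Matrix (Fin n) (Fin n) ℝ) t,
      matInner Q (N t) = (v t - d) * Q e.1 e.2 + (p t - d₀) * Q e₀.1 e₀.2 := fun Q t => by
    rw [matInner_comm]
    simp only [N, matInner_add_left, matInner_smul_left]
    rw [matInner_comm (unit e), matInner_comm (unit e₀), matInner_unit, matInner_unit]
  have hev1 : ∀ᶠ t in 𝓝 (0 : ℝ), 0 < 1 + (d ^ 2 - v t ^ 2) / d₀ ^ 2 := by
    have hcont : Continuous fun t => 1 + (d ^ 2 - v t ^ 2) / d₀ ^ 2 := by fun_prop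
    exact (hcont.tendsto 0).eventually (lt_mem_nhds (by simp [hv0]))
  have hpt : Tendsto (fun t => (p t : EReal)) (𝓝 0) (𝓝 (d₀ : EReal)) := by
    have := (continuous_coe_real_ereal.comp hpc).tendsto 0
    simpa only [Function.comp_def, hp0] using this
  have hev2 : ∀ᶠ t in 𝓝 (0 : ℝ), (v t - d) ^ 2 + (p t - d₀) ^ 2 < (θ * δ) ^ 2 := by
    have hcont : Continuous fun t => (v t - d) ^ 2 + (p t - d₀) ^ 2 := by fun_prop
    refine (hcont.tendsto 0).eventually (gt_mem_nhds ?_)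
    simp only [hv0, hp0, sub_self]
    have : 0 < (θ * δ) ^ 2 := by positivity
    linarith
  have hev : ∀ᶠ t in 𝓝[>] (0 : ℝ), _ := nhdsWithin_le_nhds
    (hev1.and (hev2.and ((hpt.eventually (lt_mem_nhds hl)).and
      ((hpt.eventually (gt_mem_nhds hu)).and (eventually_lt_nhds one_pos)))))
  obtain ⟨t, ⟨h1, h2, h3, h4, h6⟩, h5⟩ := (hev.and self_mem_nhdsWithin).exists
  have h5' : (0 : ℝ) < t := h5
  have hpsq : p t ^ 2 = d₀ ^ 2 + d ^ 2 - v t ^ 2 := by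
    simp only [p]
    rw [mul_pow, Real.sq_sqrt h1.le]
    field_simp
    ring
  have hvd : v t - d ≠ 0 := by
    simp only [v, add_sub_cancel_left]
    exact mul_ne_zero h5'.ne' (sub_ne_zero.2 hwd)
  have hNpos : 0 < frobNorm (N t) := by
    refine lt_of_le_of_ne (frobNorm_nonneg _) fun h0 => ?_
    have := hNsq t
    rw [← h0] at this
    have : 0 < (v t - d) ^ 2 := by positivity
    nlinarith [sq_nonneg (p t - d₀)]
  have hNle : frobNorm (N t) ≤ θ * δ :=
    (abs_le_of_sq_le_sq' ((hNsq t).le.trans h2.le) (by positivity)).2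
  have hNe : N t e.1 e.2 = v t - d := by simp [N, unit_apply, hne]
  have hNe₀ : N t e₀.1 e₀.2 = p t - d₀ := by simp [N, unit_apply, hne.symm]
  have hDall : D + N t ∈ S.allowed := by
    refine ⟨fun f hf => ?_, fun f hf => ?_⟩
    · have hfe : f ≠ e := fun hh => hf (hh ▸ he)
      have hfe₀ : f ≠ e₀ := fun hh => hf (hh ▸ he₀)
      simp [N, unit_apply, hfe, hfe₀, h.allowed.1 f hf]
    · by_cases hfe : f = e
      · subst hfe
        rw [Matrix.add_apply, hNe, ← hddef, add_sub_cancel]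
        exact ereal_between_convex (h.allowed.2 f hf) hw h5'.le h6.le
      · by_cases hfe₀ : f = e₀
        · subst hfe₀
          rw [Matrix.add_apply, hNe₀, ← hd₀def, add_sub_cancel]
          exact ⟨h3.le, h4.le⟩
        · simpa [N, unit_apply, hfe, hfe₀] using h.allowed.2 f hf
  have hinnD := hinner D t
  rw [← hddef, ← hd₀def] at hinnD
  have hbal : 2 * matInner D (N t) + frobNorm (N t) ^ 2 = 0 := by
    rw [hinnD, hNsq]; nlinarith
  have hMN : θ * matInner M (N t) = matInner D (N t) := by
    rw [hinnD, hinner]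
    calc θ * ((v t - d) * M e.1 e.2 + (p t - d₀) * M e₀.1 e₀.2)
        = (v t - d) * (θ * M e.1 e.2) + (p t - d₀) * (θ * M e₀.1 e₀.2) := by ring
      _ = _ := by rw [hmov, ← hm₀]
  -- Shifting `θ M` and `D` by the same `N t` leaves the residual `θ M - D` unchanged. The residual
  -- vanishes at `e` and `e₀`, hence is orthogonal to `N t`. So `D + N t` is optimal for a matrix at
  -- distance exactly `‖N t‖ / θ` from `M`.
  have hmult : IsMultiplier S ε (M + θ⁻¹ • N t) (D + N t) θ := by
    refine ⟨hθ, hDall, ?_, fun D' hD' => ?_⟩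
    · rw [← h.norm_eq]
      refine (pow_left_inj₀ (frobNorm_nonneg _) (frobNorm_nonneg _) two_ne_zero).1 ?_
      rw [frobNorm_add_sq]; linarith
    · have hres : θ • (M + θ⁻¹ • N t) - (D + N t) = θ • M - D := by
        rw [smul_add, smul_smul, mul_inv_cancel₀ hθ.ne', one_smul]; abel
      have h7 := h.proj D' hD'
      rw [hres, show D' - (D + N t) = (D' - D) - N t by abel, matInner_sub_right,
        matInner_sub_left _ _ (N t), matInner_smul_left, hMN, sub_self, sub_zero]
      exact h7
  -- At `e` and `e₀` the entries of `M` are those of `D` divided by `θ`, so they are rotated as well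
  -- and the norm of `M` is preserved.
  have hM' : frobNorm (M + θ⁻¹ • N t) ≤ 1 := by
    refine le_trans (le_of_eq ?_) hM
    refine (pow_left_inj₀ (frobNorm_nonneg _) (frobNorm_nonneg _) two_ne_zero).1 ?_
    rw [frobNorm_add_sq, frobNorm_smul, matInner_comm, matInner_smul_left, matInner_comm, mul_pow,
      sq_abs]
    have : θ⁻¹ * matInner M (N t) = θ⁻¹ ^ 2 * matInner D (N t) := by
      rw [← hMN]; field_simp
    rw [this]
    linear_combination θ⁻¹ ^ 2 * hbal
  have hdist : frobNorm (M + θ⁻¹ • N t - M) = θ⁻¹ * frobNorm (N t) := by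
    rw [add_sub_cancel_left, frobNorm_smul, abs_of_pos (inv_pos.2 hθ)]
  have h8 := hsens (M + θ⁻¹ • N t) hM' (by
    rw [hdist, inv_mul_le_iff₀ hθ]; exact hNle) (D + N t) hmult.isOptimizer
  rw [hdist, add_sub_cancel_left, ← mul_assoc] at h8
  have h9 : 1 ≤ c * ε * θ⁻¹ := by
    by_contra hcon
    push Not at hcon
    nlinarith
  rwa [← div_eq_mul_inv, le_div_iff₀ hθ, one_mul] at h9

/-- If no entry besides `e₀` is free to move, the optimizer is locally constant. -/
theorem IsMultiplier.locally_constant {θ : ℝ} (h : IsMultiplier S ε M D θ) (hε : 0 < ε)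
    {e₀ : Fin n × Fin n} (he₀ : e₀ ∈ S.edges)
    (hl : S.lo e₀ < (D e₀.1 e₀.2 : EReal)) (hu : (D e₀.1 e₀.2 : EReal) < S.hi e₀)
    (hm : M e₀.1 e₀.2 ≠ 0)
    (hfix : ∀ e ∈ S.edges, e ≠ e₀ → S.lo e < S.hi e → θ * M e.1 e.2 ≠ D e.1 e.2) :
    ∃ δ > 0, ∀ M', frobNorm (M' - M) ≤ δ → ∀ D', IsOptimizer S ε M' D' → D' = D := by
  have hm₀ := h.eq_of_unsaturated he₀ hl hu
  have hd : D e₀.1 e₀.2 ≠ 0 := by rw [hm₀]; exact mul_ne_zero h.pos.ne' hm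
  have hθ : θ = D e₀.1 e₀.2 / M e₀.1 e₀.2 := by rw [hm₀, mul_div_cancel_right₀ _ hm]
  have hM : ∀ e : Fin n × Fin n, Tendsto (fun q : Matrix (Fin n) (Fin n) ℝ ×
      Matrix (Fin n) (Fin n) ℝ => q.1 e.1 e.2) (𝓝 M ×ˢ 𝓝 D) (𝓝 (M e.1 e.2)) := fun e => by
    have : Continuous fun N : Matrix (Fin n) (Fin n) ℝ => N e.1 e.2 := by fun_prop
    exact (this.tendsto M).comp tendsto_fst
  have hD : ∀ e : Fin n × Fin n, Tendsto (fun q : Matrix (Fin n) (Fin n) ℝ ×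
      Matrix (Fin n) (Fin n) ℝ => q.2 e.1 e.2) (𝓝 M ×ˢ 𝓝 D) (𝓝 (D e.1 e.2)) := fun e => by
    have : Continuous fun N : Matrix (Fin n) (Fin n) ℝ => N e.1 e.2 := by fun_prop
    exact (this.tendsto D).comp tendsto_snd
  have hDE := (continuous_coe_real_ereal.tendsto _).comp (hD e₀)
  -- The quotient of the `e₀` entries is the multiplier of a nearby problem, so strict inequalities
  -- between `θ M_e` and `D_e` persist and keep `e` at the same bound.
  have hsign : ∀ e ∈ S.edges, ∀ᶠ q : Matrix (Fin n) (Fin n) ℝ × Matrix (Fin n) (Fin n) ℝ in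
      𝓝 M ×ˢ 𝓝 D,
      (D e.1 e.2 < θ * M e.1 e.2 →
        q.2 e.1 e.2 < q.2 e₀.1 e₀.2 / q.1 e₀.1 e₀.2 * q.1 e.1 e.2) ∧
      (θ * M e.1 e.2 < D e.1 e.2 →
        q.2 e₀.1 e₀.2 / q.1 e₀.1 e₀.2 * q.1 e.1 e.2 < q.2 e.1 e.2) := fun e _ => by
    have hlim := ((hD e₀).div (hM e₀) hm).mul (hM e)
    rw [← hθ] at hlim
    refine Filter.Eventually.and ?_ ?_
    · exact eventually_imp_distrib_left.2 fun hh => (hD e).eventually_lt hlim hh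
    · exact eventually_imp_distrib_left.2 fun hh => hlim.eventually_lt (hD e) hh
  have hpos : ∀ᶠ q : Matrix (Fin n) (Fin n) ℝ × Matrix (Fin n) (Fin n) ℝ in 𝓝 M ×ˢ 𝓝 D,
      0 < q.2 e₀.1 e₀.2 * D e₀.1 e₀.2 :=
    ((hD e₀).mul_const _).eventually (lt_mem_nhds (mul_self_pos.2 hd))
  obtain ⟨δ, hδ, hb⟩ := exists_pair_ball
    (p := fun M' D' => ((M' e₀.1 e₀.2 ≠ 0 ∧ 0 < D' e₀.1 e₀.2 * D e₀.1 e₀.2) ∧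
      S.lo e₀ < (D' e₀.1 e₀.2 : EReal) ∧ (D' e₀.1 e₀.2 : EReal) < S.hi e₀) ∧
      ∀ e ∈ S.edges, (D e.1 e.2 < θ * M e.1 e.2 →
        D' e.1 e.2 < D' e₀.1 e₀.2 / M' e₀.1 e₀.2 * M' e.1 e.2) ∧
      (θ * M e.1 e.2 < D e.1 e.2 →
        D' e₀.1 e₀.2 / M' e₀.1 e₀.2 * M' e.1 e.2 < D' e.1 e.2))
    (((((hM e₀).eventually_ne hm).and hpos).and ((hDE.eventually (lt_mem_nhds hl)).and
      (hDE.eventually (gt_mem_nhds hu)))).and ((Filter.eventually_all_finset _).2 hsign))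
    (mul_pos two_pos h.pos)
  refine ⟨δ, hδ, fun M' hM' D' hD' => ?_⟩
  obtain ⟨⟨⟨h1, h2⟩, h3, h4⟩, h5⟩ := hb M' D' hM' (h.dist_le hD')
  obtain ⟨θ', hθ'⟩ := hD'.exists_multiplier hε ⟨e₀, he₀, h3, h4, h1⟩
  have hm₀' := hθ'.eq_of_unsaturated he₀ h3 h4
  have hθ'eq : D' e₀.1 e₀.2 / M' e₀.1 e₀.2 = θ' := by rw [hm₀', mul_div_cancel_right₀ _ h1]
  rw [hθ'eq] at h5
  have hother : ∀ e ≠ e₀, D' e.1 e.2 = D e.1 e.2 := by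
    intro e hne
    by_cases he : e ∈ S.edges
    · rcases (((h.allowed.2 e he).1.trans (h.allowed.2 e he).2)).eq_or_lt with h6 | h6
      · have h7 := (le_antisymm (hθ'.allowed.2 e he).2 (h6 ▸ (hθ'.allowed.2 e he).1))
        have h8 := (le_antisymm (h.allowed.2 e he).2 (h6 ▸ (h.allowed.2 e he).1))
        exact EReal.coe_eq_coe_iff.1 (h7.trans h8.symm)
      · rcases lt_or_gt_of_ne (hfix e he hne h6) with h7 | h7
        · have h8 : S.lo e = (D e.1 e.2 : EReal) := by
            by_contra hc
            exact absurd (h.ge_of_lo_lt he (lt_of_le_of_ne (h.allowed.2 e he).1 hc)) (not_le.2 h7)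
          have h9 : S.lo e = (D' e.1 e.2 : EReal) := by
            by_contra hc
            exact absurd (hθ'.ge_of_lo_lt he (lt_of_le_of_ne (hθ'.allowed.2 e he).1 hc))
              (not_le.2 ((h5 e he).2 h7))
          exact EReal.coe_eq_coe_iff.1 (h9.symm.trans h8)
        · have h8 : (D e.1 e.2 : EReal) = S.hi e := by
            by_contra hc
            exact absurd (h.le_of_lt_hi he (lt_of_le_of_ne (h.allowed.2 e he).2 hc)) (not_le.2 h7)
          have h9 : (D' e.1 e.2 : EReal) = S.hi e := by
            by_contra hc
            exact absurd (hθ'.le_of_lt_hi he (lt_of_le_of_ne (hθ'.allowed.2 e he).2 hc))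
              (not_le.2 ((h5 e he).1 h7))
          exact EReal.coe_eq_coe_iff.1 (h9.trans h8.symm)
    · rw [h.allowed.1 e he, hθ'.allowed.1 e he]
  -- All other entries agree, so the common norm `ε` determines the `e₀` entry up to sign; the sign
  -- comes from nearness to `D`.
  have hsum : D' e₀.1 e₀.2 ^ 2 = D e₀.1 e₀.2 ^ 2 := by
    have h6 := frobNorm_sq D
    have h7 := frobNorm_sq D'
    rw [h.norm_eq] at h6
    rw [hθ'.norm_eq, h6, ← Finset.add_sum_erase _ _ (Finset.mem_univ e₀),
      ← Finset.add_sum_erase (a := e₀) _ _ (Finset.mem_univ e₀)] at h7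
    have h8 : ∑ e ∈ Finset.univ.erase e₀, D e.1 e.2 ^ 2 =
        ∑ e ∈ Finset.univ.erase e₀, D' e.1 e.2 ^ 2 :=
      Finset.sum_congr rfl fun e he => by rw [hother e (Finset.ne_of_mem_erase he)]
    linarith
  ext i j
  by_cases hij : (i, j) = e₀
  · subst hij
    rcases sq_eq_sq_iff_eq_or_eq_neg.1 hsum with h6 | h6
    · exact h6
    · rw [h6] at h2
      nlinarith [mul_self_nonneg (D i j)]
  · exact hother (i, j) hij

/-- A sensitivity constant is at least one, unless the optimizer is locally constant. -/
theorem IsSensitivityConstant.one_le_or (hε : 0 < ε) (hM : frobNorm M ≤ 1)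
    (hD : IsOptimizer S ε M D) (hs : NonSaturated S M D) {c : ℝ}
    (hc : IsSensitivityConstant S ε M D c) :
    1 ≤ c ∨ ∃ δ > 0, ∀ M', frobNorm (M' - M) ≤ δ → ∀ D', IsOptimizer S ε M' D' → D' = D := by
  obtain ⟨θ, h⟩ := hD.exists_multiplier hε hs
  obtain ⟨e₀, he₀, hl, hu, hm⟩ := hs
  have hd : D e₀.1 e₀.2 ≠ 0 := by
    rw [h.eq_of_unsaturated he₀ hl hu]; exact mul_ne_zero h.pos.ne' hm
  by_cases hmov : ∃ e ∈ S.edges, e ≠ e₀ ∧ S.lo e < S.hi e ∧ θ * M e.1 e.2 = D e.1 e.2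
  · obtain ⟨e, he, hne, hlt, heq⟩ := hmov
    have h1 := h.le_of_movable hM he₀ hl hu hd he hne hlt heq hc
    have h2 := h.eps_le hε hM
    left
    by_contra hcon
    push Not at hcon
    nlinarith
  · push Not at hmov
    exact Or.inr (h.locally_constant hε he₀ hl hu hm hmov)

end StructuredPseudospectrum

/-! ### Perturbation of a simple eigenvalue and its eigenvectors in a Hilbert space. -/

namespace StructuredPseudospectrum

open ComplexConjugate

/-- For a complex number `a + ib` of modulus close to `1`, nearly real and not close to `-1`, the
real part is `1` up to second order. The linear part of its distance to `1` thus comes from `b`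
only. -/
theorem one_sub_le_of_sq_add_sq {a b k Z Z' : ℝ} (hZ : 0 ≤ Z) (hZ' : 0 ≤ Z') (hk : Z + Z' ≤ k)
    (hk1 : k ≤ 1 / 50) (h : a ^ 2 + b ^ 2 = (1 - Z' ^ 2) * (1 - Z ^ 2)) (ha : -k ≤ a)
    (hb : |b| ≤ k) : a ≤ 1 ∧ 1 - 2 * k ^ 2 ≤ a := by
  have hk0 : 0 ≤ k := (add_nonneg hZ hZ').trans hk
  have hb2 : b ^ 2 ≤ k ^ 2 := sq_le_sq' (abs_le.1 hb).1 (abs_le.1 hb).2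
  have hZsq : Z ^ 2 + Z' ^ 2 ≤ k ^ 2 := by nlinarith [mul_nonneg hZ hZ']
  have hksq : k ^ 2 ≤ 1 / 2500 := by nlinarith
  have hprod : (1 - Z' ^ 2) * (1 - Z ^ 2) ≤ 1 :=
    mul_le_one₀ (by nlinarith) (by nlinarith) (by nlinarith)
  have h1 : 1 - 2 * k ^ 2 ≤ a ^ 2 := by
    nlinarith [mul_nonneg (sq_nonneg Z) (sq_nonneg Z')]
  have h2 : a ^ 2 ≤ 1 := by nlinarith [sq_nonneg b]
  have h3 : a ≤ 1 := (abs_le_of_sq_le_sq' (by simpa using h2) zero_le_one).2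
  have h4 : 0 ≤ a := by
    by_contra hneg
    push Not at hneg
    have : a ^ 2 ≤ k ^ 2 := sq_le_sq' ha (hneg.le.trans hk0)
    linarith
  exact ⟨h3, by nlinarith⟩

section Hilbert

variable {V : Type*} [NormedAddCommGroup V] [InnerProductSpace ℂ V]

local notation "⟪" x ", " y "⟫" => inner ℂ x y

theorem norm_sq_eq_add_of_unit {y : V} (hy : ‖y‖ = 1) (z : V) :
    ‖z‖ ^ 2 = ‖⟪y, z⟫‖ ^ 2 + ‖z - ⟪y, z⟫ • y‖ ^ 2 := by
  have h0 : ⟪⟪y, z⟫ • y, z - ⟪y, z⟫ • y⟫ = 0 := by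
    rw [inner_smul_left, inner_sub_right, inner_smul_right, inner_self_eq_norm_sq_to_K, hy]
    simp
  have h := norm_add_sq_eq_norm_sq_add_norm_sq_of_inner_eq_zero _ _ h0
  rw [add_sub_cancel, norm_smul, hy] at h
  nlinarith

/-- The components along `y` cancel, and Cauchy–Schwarz for the two pairs of lengths gives the
constant `1` instead of the `2` of the triangle inequality. This saving goes into the constant of
the final rate. -/
theorem norm_smul_sub_smul_le {y u q : V} (hy : ‖y‖ = 1) (hu : ‖u‖ = 1) :
    ‖⟪y, q⟫ • u - ⟪y, u⟫ • q‖ ≤ ‖q‖ := by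
  have h1 := norm_sq_eq_add_of_unit hy u
  have h2 := norm_sq_eq_add_of_unit hy q
  have h3 : ⟪y, q⟫ • u - ⟪y, u⟫ • q =
      ⟪y, q⟫ • (u - ⟪y, u⟫ • y) - ⟪y, u⟫ • (q - ⟪y, q⟫ • y) := by
    simp only [smul_sub, smul_smul, mul_comm ⟪y, q⟫]
    abel
  have h4 := norm_sub_le (⟪y, q⟫ • (u - ⟪y, u⟫ • y)) (⟪y, u⟫ • (q - ⟪y, q⟫ • y))
  rw [← h3, norm_smul, norm_smul] at h4
  rw [hu] at h1
  refine (abs_le_of_sq_le_sq' ?_ (norm_nonneg q)).2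
  refine (pow_le_pow_left₀ (norm_nonneg _) h4 2).trans ?_
  set p := ‖⟪y, q⟫‖
  set t := ‖⟪y, u⟫‖
  set u' := ‖u - ⟪y, u⟫ • y‖
  set q' := ‖q - ⟪y, q⟫ • y‖
  have h5 : (p * u' + t * q') ^ 2 + (p * t - u' * q') ^ 2 =
      (p ^ 2 + q' ^ 2) * (t ^ 2 + u' ^ 2) := by ring
  rw [← h1, ← h2] at h5
  nlinarith [sq_nonneg (p * t - u' * q')]

theorem norm_add_tails_le {x y u v : V} (hv : ‖y‖ = 1) (hvv : ‖v‖ = 1) (hu : ‖u‖ = 1) :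
    ‖conj ⟪y, v⟫ * ⟪y, u - ⟪x, u⟫ • x⟫ + ⟪v - ⟪y, v⟫ • y, u⟫‖ ≤
      ‖u - ⟪x, u⟫ • x‖ + ‖v - ⟪y, v⟫ • y‖ := by
  have h1 : ‖⟪y, v⟫‖ ≤ 1 := by simpa [hv, hvv] using norm_inner_le_norm (𝕜 := ℂ) y v
  have h2 := norm_inner_le_norm (𝕜 := ℂ) y (u - ⟪x, u⟫ • x)
  have h3 := norm_inner_le_norm (𝕜 := ℂ) (v - ⟪y, v⟫ • y) u
  rw [hv, one_mul] at h2
  rw [hu, mul_one] at h3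
  refine (norm_add_le _ _).trans (add_le_add ?_ h3)
  rw [norm_mul, RCLike.norm_conj]
  calc ‖⟪y, v⟫‖ * ‖⟪y, u - ⟪x, u⟫ • x⟫‖ ≤ 1 * ‖u - ⟪x, u⟫ • x‖ :=
        mul_le_mul h1 h2 (norm_nonneg _) zero_le_one
    _ = _ := one_mul _

variable [FiniteDimensional ℂ V]

/-- `x` and `y` are unit right and left eigenvectors of `T` for `lam` with `⟪y, x⟫ = τ > 0`, and
`T - lam` is bounded below by `s > 0` on the orthogonal complement of `x`. -/
structure IsSimplePair (T : V →L[ℂ] V) (lam : ℂ) (x y : V) (τ s : ℝ) : Prop where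
  right : T x = lam • x
  left : ContinuousLinearMap.adjoint T y = conj lam • y
  norm_right : ‖x‖ = 1
  norm_left : ‖y‖ = 1
  inner_eq : ⟪y, x⟫ = τ
  τ_pos : 0 < τ
  s_pos : 0 < s
  lower : ∀ z, ⟪x, z⟫ = 0 → s * ‖z‖ ≤ ‖T z - lam • z‖

variable {T E : V →L[ℂ] V} {lam μ : ℂ} {x y u v : V} {τ s : ℝ}

theorem IsSimplePair.inner_left (h : IsSimplePair T lam x y τ s) (z : V) :
    ⟪y, T z - lam • z⟫ = 0 := by
  rw [inner_sub_right, inner_smul_right, ← ContinuousLinearMap.adjoint_inner_left, h.left,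
    inner_smul_left]
  simp

theorem IsSimplePair.τ_le_one (h : IsSimplePair T lam x y τ s) : τ ≤ 1 := by
  have h1 := norm_inner_le_norm (𝕜 := ℂ) y x
  rw [h.inner_eq, h.norm_left, h.norm_right, Complex.norm_real, Real.norm_eq_abs] at h1
  linarith [le_abs_self τ]

/-- `T - lam` maps the complement of `x` injectively into that of `y`, and both have the same
dimension. -/
theorem IsSimplePair.exists_preimage (h : IsSimplePair T lam x y τ s) {z' : V}
    (hz' : ⟪y, z'⟫ = 0) : ∃ z, ⟪x, z⟫ = 0 ∧ T z - lam • z = z' := by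
  let f : (ℂ ∙ x)ᗮ →ₗ[ℂ] (ℂ ∙ y)ᗮ :=
    LinearMap.restrict ((T : V →ₗ[ℂ] V) - lam • LinearMap.id) fun z _ =>
      Submodule.mem_orthogonal_singleton_iff_inner_right.2 (h.inner_left z)
  have hinj : Function.Injective f := by
    refine (injective_iff_map_eq_zero f).2 fun z hz => ?_
    have h1 := h.lower z (Submodule.mem_orthogonal_singleton_iff_inner_right.1 z.2)
    have h2 : T z - lam • (z : V) = 0 := congrArg Subtype.val hz
    rw [h2, norm_zero] at h1
    have h3 : ‖(z : V)‖ ≤ 0 := by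
      by_contra hc
      push Not at hc
      nlinarith [mul_pos h.s_pos hc]
    exact Subtype.ext (norm_le_zero_iff.1 h3)
  have hx : x ≠ 0 := norm_ne_zero_iff.1 (by rw [h.norm_right]; exact one_ne_zero)
  have hy : y ≠ 0 := norm_ne_zero_iff.1 (by rw [h.norm_left]; exact one_ne_zero)
  have hdim : Module.finrank ℂ (ℂ ∙ x)ᗮ = Module.finrank ℂ (ℂ ∙ y)ᗮ := by
    have h1 := Submodule.finrank_add_finrank_orthogonal (ℂ ∙ x)
    have h2 := Submodule.finrank_add_finrank_orthogonal (ℂ ∙ y)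
    rw [finrank_span_singleton hx] at h1
    rw [finrank_span_singleton hy] at h2
    omega
  have hsurj := (LinearMap.injective_iff_surjective_of_finrank_eq_finrank hdim).1 hinj
  obtain ⟨z, hz⟩ := hsurj ⟨z', Submodule.mem_orthogonal_singleton_iff_inner_right.2 hz'⟩
  exact ⟨z, Submodule.mem_orthogonal_singleton_iff_inner_right.1 z.2, congrArg Subtype.val hz⟩

/-- Right and left eigenvectors exchange their roles for the adjoint. -/
theorem IsSimplePair.adjoint (h : IsSimplePair T lam x y τ s) :
    IsSimplePair (ContinuousLinearMap.adjoint T) (conj lam) y x τ s where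
  right := h.left
  left := by rw [ContinuousLinearMap.adjoint_adjoint, h.right, Complex.conj_conj]
  norm_right := h.norm_left
  norm_left := h.norm_right
  inner_eq := by rw [← inner_conj_symm, h.inner_eq, Complex.conj_ofReal]
  τ_pos := h.τ_pos
  s_pos := h.s_pos
  lower := fun z' hz' => by
    -- With `z' = (T - lam) z`, one has `‖z'‖² = ⟪(T - lam)^* z', z⟫ ≤ ‖(T - lam)^* z'‖ ‖z'‖ / s`,
    -- so the adjoint inherits the same `s`.
    obtain ⟨z, hz, rfl⟩ := h.exists_preimage hz'
    set z' := T z - lam • z with hz'def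
    have h1 := h.lower z hz
    have h2 : ⟪ContinuousLinearMap.adjoint T z' - conj lam • z', z⟫ = ⟪z', z'⟫ := by
      rw [inner_sub_left, ContinuousLinearMap.adjoint_inner_left, inner_smul_left,
        Complex.conj_conj, ← inner_smul_right, ← inner_sub_right]
    have h3 := norm_inner_le_norm (𝕜 := ℂ) (ContinuousLinearMap.adjoint T z' - conj lam • z') z
    rw [h2, inner_self_eq_norm_sq_to_K] at h3
    simp only [norm_pow, Complex.coe_algebraMap, Complex.norm_real, norm_norm] at h3
    rcases (norm_nonneg z').eq_or_lt with h0 | h0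
    · rw [← h0, mul_zero]; exact norm_nonneg _
    · set R := ‖ContinuousLinearMap.adjoint T z' - conj lam • z'‖ with hR
      have hR0 : 0 ≤ R := norm_nonneg _
      have h4 := h.s_pos
      have h5 : s * ‖z'‖ * ‖z'‖ ≤ R * ‖z'‖ := by
        calc s * ‖z'‖ * ‖z'‖ = s * ‖z'‖ ^ 2 := by ring
          _ ≤ s * (R * ‖z‖) := mul_le_mul_of_nonneg_left h3 h4.le
          _ = R * (s * ‖z‖) := by ring
          _ ≤ R * ‖z'‖ := mul_le_mul_of_nonneg_left h1 hR0
      exact le_of_mul_le_mul_right h5 h0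

/-- The estimates for a unit eigenvector `u` of `T + E` for an eigenvalue `μ` near `lam`. -/
structure EigenvectorEstimate (E : V →L[ℂ] V) (lam μ : ℂ) (x y u : V) (τ s : ℝ) : Prop where
  tail_le : ‖u - ⟪x, u⟫ • x‖ ≤ τ / 100
  tail_le_norm : s * (49 / 50 * τ) * ‖u - ⟪x, u⟫ • x‖ ≤ ‖E‖
  inner_ge : 49 / 50 * τ ≤ ‖⟪y, u⟫‖
  coeff_sq : ‖⟪x, u⟫‖ ^ 2 = 1 - ‖u - ⟪x, u⟫ • x‖ ^ 2
  coeff_ge : 99 / 100 ≤ ‖⟪x, u⟫‖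
  eigenvalue_le : 49 / 50 * τ * ‖μ - lam‖ ≤ ‖E‖

theorem IsSimplePair.inner_eq_add (h : IsSimplePair T lam x y τ s) (u : V) :
    ⟪y, u⟫ = ⟪x, u⟫ * τ + ⟪y, u - ⟪x, u⟫ • x⟫ := by
  rw [inner_sub_right, inner_smul_right, h.inner_eq]
  ring

/-- A bootstrap on the residual `w = T u - lam u = (μ - lam) u - E u`. The hypothesis `hnear` gives
a crude bound on the tail of `u`, hence `|⟪y, u⟫| ≥ (99/100 - 1/100) τ`. Since `w` is orthogonal to
`y`, `μ - lam` can be eliminated, and the bounds become linear in `‖E‖` alone. -/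
theorem IsSimplePair.estimate (h : IsSimplePair T lam x y τ s) (hu : ‖u‖ = 1)
    (hT : T u + E u = μ • u) (hnear : ‖μ - lam‖ + ‖E‖ ≤ s * τ / 100) :
    EigenvectorEstimate E lam μ x y u τ s := by
  have hτ := h.τ_pos
  have hs := h.s_pos
  have hτ1 := h.τ_le_one
  set w := T u - lam • u with hw
  set z := u - ⟪x, u⟫ • x with hz
  have hw' : w = (μ - lam) • u - E u := by
    rw [hw, sub_smul, ← hT]; abel
  have hEu : ‖E u‖ ≤ ‖E‖ := by simpa [hu] using E.le_opNorm u
  have hwz : s * ‖z‖ ≤ ‖w‖ := by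
    have h1 := h.lower z (by
      rw [hz, inner_sub_right, inner_smul_right, inner_self_eq_norm_sq_to_K, h.norm_right]
      simp)
    have h2 : T z - lam • z = w := by
      rw [hz, hw, map_sub, map_smul, h.right, smul_sub, smul_comm lam ⟪x, u⟫]
      abel
    rwa [h2] at h1
  have hw1 : ‖w‖ ≤ ‖μ - lam‖ + ‖E‖ := by
    rw [hw']
    refine (norm_sub_le _ _).trans (add_le_add ?_ hEu)
    rw [norm_smul, hu, mul_one]
  have hz1 : ‖z‖ ≤ τ / 100 := by
    refine le_of_mul_le_mul_left ?_ hs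
    calc s * ‖z‖ ≤ s * τ / 100 := (hwz.trans hw1).trans hnear
      _ = s * (τ / 100) := by ring
  have hasq := norm_sq_eq_add_of_unit h.norm_right u
  rw [hu, ← hz] at hasq
  have hz0 := norm_nonneg z
  have ha0 := norm_nonneg ⟪x, u⟫
  have ha : 99 / 100 ≤ ‖⟪x, u⟫‖ := by
    by_contra hc
    push Not at hc
    nlinarith
  have hyz : ‖⟪y, z⟫‖ ≤ ‖z‖ := by
    simpa [h.norm_left] using norm_inner_le_norm (𝕜 := ℂ) y z
  have hyu : 49 / 50 * τ ≤ ‖⟪y, u⟫‖ := by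
    have h1 := h.inner_eq_add u
    rw [← hz] at h1
    have h2 : ‖⟪x, u⟫ * τ‖ ≤ ‖⟪y, u⟫‖ + ‖⟪y, z⟫‖ := by
      rw [show ⟪x, u⟫ * τ = ⟪y, u⟫ - ⟪y, z⟫ by rw [h1]; ring]
      exact norm_sub_le _ _
    rw [norm_mul, Complex.norm_real, Real.norm_of_nonneg hτ.le] at h2
    nlinarith
  have hp : (μ - lam) * ⟪y, u⟫ = ⟪y, E u⟫ := by
    have h1 := h.inner_left u
    rw [← hw, hw', inner_sub_right, inner_smul_right] at h1
    exact sub_eq_zero.1 h1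
  -- Here `⟪y, u⟫ w = ⟪y, E u⟫ u - ⟪y, u⟫ E u`.
  have hres : ‖⟪y, u⟫‖ * ‖w‖ ≤ ‖E‖ := by
    rw [← norm_smul, hw', smul_sub, smul_smul, mul_comm, hp]
    exact (norm_smul_sub_smul_le h.norm_left hu).trans hEu
  refine ⟨hz1, ?_, hyu, by linarith, ha, ?_⟩
  · calc s * (49 / 50 * τ) * ‖z‖ = 49 / 50 * τ * (s * ‖z‖) := by ring
      _ ≤ ‖⟪y, u⟫‖ * ‖w‖ := mul_le_mul hyu hwz (by positivity) (norm_nonneg _)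
      _ ≤ ‖E‖ := hres
  · calc 49 / 50 * τ * ‖μ - lam‖ ≤ ‖⟪y, u⟫‖ * ‖μ - lam‖ :=
          mul_le_mul_of_nonneg_right hyu (norm_nonneg _)
      _ = ‖⟪y, E u⟫‖ := by rw [← hp, norm_mul, mul_comm]
      _ ≤ ‖y‖ * ‖E u‖ := norm_inner_le_norm _ _
      _ ≤ ‖E‖ := by rw [h.norm_left, one_mul]; exact hEu

/-- Eigenvalues near a simple eigenvalue are Lipschitz. -/
theorem IsSimplePair.eigenvalue_le (h : IsSimplePair T lam x y τ s) (hu : ‖u‖ = 1)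
    (hT : T u + E u = μ • u) (hnear : ‖μ - lam‖ + ‖E‖ ≤ s * τ / 100) :
    ‖μ - lam‖ ≤ 2 / τ * ‖E‖ := by
  have h1 := (h.estimate hu hT hnear).eigenvalue_le
  have hτ := h.τ_pos
  rw [div_mul_eq_mul_div, le_div_iff₀ hτ]
  nlinarith [norm_nonneg E]

/-- First-order expansion of a simple eigenvalue. -/
theorem IsSimplePair.first_order (h : IsSimplePair T lam x y τ s) (hu : ‖u‖ = 1)
    (hT : T u + E u = μ • u) (hnear : ‖μ - lam‖ + ‖E‖ ≤ s * τ / 100) :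
    ‖τ * (μ - lam) - ⟪y, E x⟫‖ ≤ 10 / (s * τ ^ 2) * ‖E‖ ^ 2 := by
  have hest := h.estimate hu hT hnear
  have hτ := h.τ_pos
  have hs := h.s_pos
  have hτ1 := h.τ_le_one
  have hlip := h.eigenvalue_le hu hT hnear
  set z := u - ⟪x, u⟫ • x with hz
  have hyz : ‖⟪y, z⟫‖ ≤ ‖z‖ := by
    simpa [h.norm_left] using norm_inner_le_norm (𝕜 := ℂ) y z
  have hyEz : ‖⟪y, E z⟫‖ ≤ ‖E‖ * ‖z‖ := by
    refine (norm_inner_le_norm (𝕜 := ℂ) y (E z)).trans ?_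
    rw [h.norm_left, one_mul]; exact E.le_opNorm z
  have hp : (μ - lam) * ⟪y, u⟫ = ⟪y, E u⟫ := by
    have h1 := h.inner_left u
    have hw' : T u - lam • u = (μ - lam) • u - E u := by
      rw [sub_smul, ← hT]; abel
    rw [hw', inner_sub_right, inner_smul_right] at h1
    exact sub_eq_zero.1 h1
  have hEu : ⟪y, E u⟫ = ⟪x, u⟫ * ⟪y, E x⟫ + ⟪y, E z⟫ := by
    rw [hz, map_sub, map_smul, inner_sub_right, inner_smul_right]; ring
  rw [h.inner_eq_add u, hEu, ← hz] at hp
  -- Both terms on the right carry the tail `z = O(‖E‖)` besides a factor `O(‖E‖)`, so the error is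
  -- quadratic.
  have hid : ⟪x, u⟫ * (τ * (μ - lam) - ⟪y, E x⟫) = ⟪y, E z⟫ - (μ - lam) * ⟪y, z⟫ := by
    linear_combination hp
  set Q := ‖(τ : ℂ) * (μ - lam) - ⟪y, E x⟫‖ with hQ
  have h1 : ‖⟪x, u⟫‖ * Q ≤ ‖E‖ * ‖z‖ + ‖μ - lam‖ * ‖z‖ := by
    rw [hQ, ← norm_mul, hid]
    refine (norm_sub_le _ _).trans (add_le_add hyEz ?_)
    rw [norm_mul]
    exact mul_le_mul_of_nonneg_left hyz (norm_nonneg _)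
  have h2 : 99 / 100 * Q ≤ ‖⟪x, u⟫‖ * Q :=
    mul_le_mul_of_nonneg_right hest.coeff_ge (norm_nonneg _)
  have hE1 : ‖E‖ ≤ 1 / τ * ‖E‖ := by
    rw [one_div, inv_mul_eq_div, le_div_iff₀ hτ]
    nlinarith [norm_nonneg E]
  have h3 : ‖E‖ * ‖z‖ + ‖μ - lam‖ * ‖z‖ ≤ 3 / τ * ‖E‖ * ‖z‖ := by
    rw [← add_mul]
    refine mul_le_mul_of_nonneg_right ?_ (norm_nonneg z)
    calc ‖E‖ + ‖μ - lam‖ ≤ 1 / τ * ‖E‖ + 2 / τ * ‖E‖ := add_le_add hE1 hlip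
      _ = 3 / τ * ‖E‖ := by ring
  have h4 := hest.tail_le_norm
  rw [← hz] at h4
  have h5 : ‖z‖ ≤ 50 / 49 / (s * τ) * ‖E‖ := by
    rw [div_mul_eq_mul_div, le_div_iff₀ (by positivity)]
    nlinarith
  have h6 : 3 / τ * ‖E‖ * ‖z‖ ≤ 3 / τ * ‖E‖ * (50 / 49 / (s * τ) * ‖E‖) :=
    mul_le_mul_of_nonneg_left h5 (by positivity)
  have h7 : 3 / τ * ‖E‖ * (50 / 49 / (s * τ) * ‖E‖) = 150 / 49 * (‖E‖ ^ 2 / (s * τ ^ 2)) := by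
    field_simp
    ring
  have h8 : 10 / (s * τ ^ 2) * ‖E‖ ^ 2 = 10 * (‖E‖ ^ 2 / (s * τ ^ 2)) := by ring
  have h9 : 0 ≤ ‖E‖ ^ 2 / (s * τ ^ 2) := by positivity
  rw [h8]
  linarith

/-- RP-compatibility constrains `⟪v, u⟫`, while the rank-one matrix depends on `conj ⟪y, v⟫ * ⟪x,
u⟫`; the identity links the two up to tails. -/
theorem IsSimplePair.inner_pair (h : IsSimplePair T lam x y τ s) (u v : V) :
    conj ⟪y, v⟫ * ⟪x, u⟫ * τ = ⟪v, u⟫ - conj ⟪y, v⟫ * ⟪y, u - ⟪x, u⟫ • x⟫ -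
      ⟪v - ⟪y, v⟫ • y, u⟫ := by
  rw [inner_sub_left, inner_smul_left, h.inner_eq_add u]
  ring

/-- Orthogonality would make `(99/100)² τ` at most the sum of the two tails, which is at most `τ /
50`. Non-orthogonal eigenvectors can be normalized to be RP-compatible. -/
theorem IsSimplePair.inner_ne_zero (h : IsSimplePair T lam x y τ s) (hu : ‖u‖ = 1) (hv : ‖v‖ = 1)
    (hT : T u + E u = μ • u)
    (hT' : ContinuousLinearMap.adjoint T v + ContinuousLinearMap.adjoint E v = conj μ • v)
    (hnear : ‖μ - lam‖ + ‖E‖ ≤ s * τ / 100) : ⟪v, u⟫ ≠ 0 := by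
  have hest := h.estimate hu hT hnear
  have hest' := h.adjoint.estimate hv hT' (by
    rwa [← map_sub, RCLike.norm_conj, LinearIsometryEquiv.norm_map])
  have hτ := h.τ_pos
  intro h0
  have h1 := h.inner_pair u v
  rw [h0, zero_sub, sub_eq_add_neg, ← neg_add] at h1
  have h2 := congrArg norm h1
  rw [norm_neg, norm_mul, norm_mul, RCLike.norm_conj, Complex.norm_real,
    Real.norm_of_nonneg hτ.le] at h2
  have h3 := norm_add_tails_le (x := x) h.norm_left hv hu
  have h4 := hest.tail_le
  have h5 := hest'.tail_le
  have h6 : 99 / 100 * (99 / 100) ≤ ‖⟪y, v⟫‖ * ‖⟪x, u⟫‖ :=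
    mul_le_mul hest'.coeff_ge hest.coeff_ge (by norm_num) (norm_nonneg _)
  have h7 := mul_le_mul_of_nonneg_right h6 hτ.le
  linarith

/-- Perturbation of the rank-one matrix of RP-compatible eigenvectors: the scalar error and the
two tails. -/
theorem IsSimplePair.rank_one_bound (h : IsSimplePair T lam x y τ s) (hu : ‖u‖ = 1)
    (hv : ‖v‖ = 1) (hT : T u + E u = μ • u)
    (hT' : ContinuousLinearMap.adjoint T v + ContinuousLinearMap.adjoint E v = conj μ • v)
    (hnear : ‖μ - lam‖ + ‖E‖ ≤ s * τ / 100) (him : ⟪v, u⟫.im = 0) (hre : 0 < ⟪v, u⟫.re) :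
    ‖conj ⟪y, v⟫ * ⟪x, u⟫ - 1‖ + ‖u - ⟪x, u⟫ • x‖ + ‖v - ⟪y, v⟫ • y‖ ≤
      9 / 2 / (s * τ ^ 2) * ‖E‖ := by
  have hest := h.estimate hu hT hnear
  have hest' := h.adjoint.estimate hv hT' (by
    rwa [← map_sub, RCLike.norm_conj, LinearIsometryEquiv.norm_map])
  have hτ := h.τ_pos
  have hs := h.s_pos
  have hτ1 := h.τ_le_one
  have h1 := h.inner_pair u v
  rw [sub_sub] at h1
  have h3 := norm_add_tails_le (x := x) h.norm_left hv hu
  have h4 := hest.tail_le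
  have h5 := hest'.tail_le
  have h6 := hest.tail_le_norm
  have h7 := hest'.tail_le_norm
  rw [LinearIsometryEquiv.norm_map] at h7
  set Z := ‖u - ⟪x, u⟫ • x‖ with hZ
  set Z' := ‖v - ⟪y, v⟫ • y‖ with hZ'
  set c := conj ⟪y, v⟫ * ⟪x, u⟫ with hc
  set q := conj ⟪y, v⟫ * ⟪y, u - ⟪x, u⟫ • x⟫ + ⟪v - ⟪y, v⟫ • y, u⟫ with hq
  have hZ0 : 0 ≤ Z := norm_nonneg _
  have hZ0' : 0 ≤ Z' := norm_nonneg _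
  -- All errors are measured by `k`: since `⟪v, u⟫` is real and positive, the scalar `c` has real
  -- part at least `-k` and imaginary part at most `k` in modulus.
  obtain ⟨k, hk⟩ : ∃ k, k = (Z + Z') / τ := ⟨_, rfl⟩
  have hkτ : k * τ = Z + Z' := by rw [hk, div_mul_cancel₀ _ hτ.ne']
  have hk0 : 0 ≤ k := hk ▸ div_nonneg (add_nonneg hZ0 hZ0') hτ.le
  have hk1 : k ≤ 1 / 50 := by
    rw [hk, div_le_iff₀ hτ]; linarith
  have hreq : c.re * τ = ⟪v, u⟫.re - q.re := by
    simpa using congrArg Complex.re h1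
  have himq : c.im * τ = ⟪v, u⟫.im - q.im := by
    simpa using congrArg Complex.im h1
  have hqre := (Complex.abs_re_le_norm q).trans h3
  have hqim := (Complex.abs_im_le_norm q).trans h3
  have hre1 : -k ≤ c.re := by
    have := (abs_le.1 hqre).2
    refine le_of_mul_le_mul_right ?_ hτ
    linarith
  have him1 : |c.im| ≤ k := by
    refine le_of_mul_le_mul_right ?_ hτ
    rw [hkτ]
    calc |c.im| * τ = |c.im * τ| := by rw [abs_mul, abs_of_pos hτ]
      _ = |q.im| := by rw [himq, him, zero_sub, abs_neg]
      _ ≤ _ := hqim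
  have hcsq : c.re ^ 2 + c.im ^ 2 = (1 - Z' ^ 2) * (1 - Z ^ 2) := by
    rw [← hest.coeff_sq, ← hest'.coeff_sq, ← mul_pow, ← RCLike.norm_conj ⟪y, v⟫, ← norm_mul, ← hc,
      ← Complex.normSq_eq_norm_sq, Complex.normSq_apply]
    ring
  have hZk : Z + Z' ≤ k := by rw [← hkτ]; nlinarith
  obtain ⟨hre3, hre4⟩ := one_sub_le_of_sq_add_sq hZ0 hZ0' hZk hk1 hcsq hre1 him1
  have hc1 : ‖c - 1‖ ≤ 2 * k ^ 2 + k := by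
    refine (Complex.norm_le_abs_re_add_abs_im _).trans ?_
    simp only [Complex.sub_re, Complex.one_re, Complex.sub_im, Complex.one_im, sub_zero]
    refine add_le_add ?_ him1
    rw [abs_sub_comm, abs_of_nonneg (by linarith)]
    linarith
  have hkE : s * τ ^ 2 * k ≤ 2 * (50 / 49) * ‖E‖ := by
    calc s * τ ^ 2 * k = s * τ * (Z + Z') := by rw [← hkτ]; ring
      _ ≤ _ := by linarith
  rw [div_mul_eq_mul_div, le_div_iff₀ (by positivity)]
  -- `2k² + k ≤ (26/25) k` because `k ≤ 1/50`, and `Z + Z' ≤ k`. With `hkE` the total is `(51/25)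
  -- (100/49) < 9/2`.
  have hfin : ‖c - 1‖ + Z + Z' ≤ 51 / 25 * k := by nlinarith
  calc (‖c - 1‖ + Z + Z') * (s * τ ^ 2) ≤ 51 / 25 * k * (s * τ ^ 2) :=
        mul_le_mul_of_nonneg_right hfin (by positivity)
    _ = 51 / 25 * (s * τ ^ 2 * k) := by ring
    _ ≤ 9 / 2 * ‖E‖ := by linarith [norm_nonneg E]

end Hilbert

end StructuredPseudospectrum

namespace StructuredPseudospectrum

open ComplexConjugate Filter Topology

variable {n : ℕ}

/-! ### Matrices as operators -/

/-- The operator on complex Euclidean space given by a real matrix. -/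
noncomputable def op (A : Matrix (Fin n) (Fin n) ℝ) :
    EuclideanSpace ℂ (Fin n) →L[ℂ] EuclideanSpace ℂ (Fin n) :=
  Matrix.toEuclideanCLM (n := Fin n) (𝕜 := ℂ) (toC A)

/-- A tuple of complex numbers as a Euclidean vector. -/
noncomputable def vec (x : Fin n → ℂ) : EuclideanSpace ℂ (Fin n) := WithLp.toLp 2 x

theorem toC_add (A B : Matrix (Fin n) (Fin n) ℝ) : toC (A + B) = toC A + toC B :=
  Matrix.map_add _ Complex.ofReal_add A B

theorem op_add (A B : Matrix (Fin n) (Fin n) ℝ) : op (A + B) = op A + op B := by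
  rw [op, toC_add, map_add]; rfl

theorem op_vec (A : Matrix (Fin n) (Fin n) ℝ) (x : Fin n → ℂ) :
    op A (vec x) = vec (toC A *ᵥ x) := rfl

theorem adjoint_op_vec (A : Matrix (Fin n) (Fin n) ℝ) (x : Fin n → ℂ) :
    ContinuousLinearMap.adjoint (op A) (vec x) = vec ((toC A)ᴴ *ᵥ x) := by
  rw [op, ← ContinuousLinearMap.star_eq_adjoint, ← map_star]; rfl

theorem vec_smul (c : ℂ) (x : Fin n → ℂ) : vec (c • x) = c • vec x := rfl

theorem vec_sub (x y : Fin n → ℂ) : vec (x - y) = vec x - vec y := rfl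

theorem vec_injective : Function.Injective (vec (n := n)) := WithLp.toLp_injective 2

theorem inner_vec (x y : Fin n → ℂ) : inner ℂ (vec x) (vec y) = star x ⬝ᵥ y := by
  rw [vec, vec, EuclideanSpace.inner_toLp_toLp, dotProduct_comm]

theorem norm_vec_sq (x : Fin n → ℂ) : ‖vec x‖ ^ 2 = ∑ i, ‖x i‖ ^ 2 :=
  EuclideanSpace.norm_sq_eq _

theorem norm_vec_eq_one {x : Fin n → ℂ} : ‖vec x‖ = 1 ↔ star x ⬝ᵥ x = 1 := by
  rw [← inner_vec, inner_self_eq_norm_sq_to_K]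
  constructor
  · intro h; rw [h]; simp
  · intro h
    have h1 : ‖vec x‖ ^ 2 = 1 := Complex.ofReal_injective (by simpa using h)
    exact (pow_eq_one_iff_of_nonneg (norm_nonneg _) two_ne_zero).1 h1

theorem norm_vec_star (x : Fin n → ℂ) : ‖vec (star x)‖ = ‖vec x‖ := by
  rw [← sq_eq_sq₀ (norm_nonneg _) (norm_nonneg _), norm_vec_sq, norm_vec_sq]
  simp

theorem conjTranspose_mulVec_eq_of_left {N : Matrix (Fin n) (Fin n) ℂ} {μ : ℂ} {v : Fin n → ℂ}
    (h : star v ᵥ* N = μ • star v) : Nᴴ *ᵥ v = conj μ • v := by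
  have h1 := congrArg star h
  rwa [Matrix.star_vecMul, star_star, star_smul, star_star] at h1

theorem twoNorm_nonneg (A : Matrix (Fin n) (Fin n) ℝ) : 0 ≤ twoNorm A := norm_nonneg _

theorem twoNorm_le_frobNorm (A : Matrix (Fin n) (Fin n) ℝ) : twoNorm A ≤ frobNorm A := by
  refine ContinuousLinearMap.opNorm_le_bound _ (frobNorm_nonneg A) fun x => ?_
  refine (abs_le_of_sq_le_sq' ?_ (mul_nonneg (frobNorm_nonneg A) (norm_nonneg x))).2
  rw [mul_pow, EuclideanSpace.norm_sq_eq, EuclideanSpace.norm_sq_eq, frobNorm_sq,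
    Fintype.sum_prod_type, Finset.sum_mul]
  refine Finset.sum_le_sum fun i _ => ?_
  simp only [Matrix.ofLp_toEuclideanCLM, Matrix.mulVec, dotProduct, Real.norm_eq_abs, sq_abs]
  exact Finset.sum_mul_sq_le_sq_mul_sq _ _ _

theorem abs_apply_le_twoNorm (A : Matrix (Fin n) (Fin n) ℝ) (i j : Fin n) :
    |A i j| ≤ twoNorm A := by
  have h := (Matrix.toEuclideanCLM (n := Fin n) (𝕜 := ℝ) A).le_opNorm (EuclideanSpace.single j 1)
  rw [PiLp.norm_single, norm_one, mul_one] at h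
  refine le_trans ?_ h
  have h1 := PiLp.norm_apply_le
    (Matrix.toEuclideanCLM (n := Fin n) (𝕜 := ℝ) A (EuclideanSpace.single j 1)) i
  rw [Matrix.ofLp_toEuclideanCLM] at h1
  simpa using h1

/-- The crude factor `n` is harmless: it is used only to compare neighbourhoods. -/
theorem frobNorm_le_mul_twoNorm (A : Matrix (Fin n) (Fin n) ℝ) :
    frobNorm A ≤ n * twoNorm A := by
  refine (abs_le_of_sq_le_sq' ?_ (mul_nonneg (Nat.cast_nonneg n) (twoNorm_nonneg A))).2
  rw [frobNorm_sq, mul_pow]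
  have h : ∀ e ∈ (Finset.univ : Finset (Fin n × Fin n)), A e.1 e.2 ^ 2 ≤ twoNorm A ^ 2 :=
    fun e _ => by
      rw [← sq_abs]
      exact pow_le_pow_left₀ (abs_nonneg _) (abs_apply_le_twoNorm A e.1 e.2) 2
  refine (Finset.sum_le_card_nsmul _ _ _ h).trans (le_of_eq ?_)
  rw [nsmul_eq_mul, Finset.card_univ, Fintype.card_prod, Fintype.card_fin]
  push_cast
  ring

theorem exists_twoNorm_ball {p : Matrix (Fin n) (Fin n) ℝ → Prop} {M : Matrix (Fin n) (Fin n) ℝ}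
    (h : ∀ᶠ N in 𝓝 M, p N) : ∃ η > 0, ∀ N, twoNorm (N - M) < η → p N := by
  obtain ⟨η, hη, hb⟩ := exists_frobNorm_ball h
  -- `n + 1` instead of `n` avoids a division by zero.
  refine ⟨η / (n + 1), by positivity, fun N hN => hb N ?_⟩
  rw [lt_div_iff₀ (by positivity)] at hN
  refine (frobNorm_le_mul_twoNorm _).trans_lt ?_
  nlinarith [twoNorm_nonneg (N - M)]

/-- A real matrix acts separately on real and imaginary parts, so complexification does not increase
the operator norm. -/
theorem norm_op_le_twoNorm (A : Matrix (Fin n) (Fin n) ℝ) : ‖op A‖ ≤ twoNorm A := by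
  refine ContinuousLinearMap.opNorm_le_bound _ (twoNorm_nonneg A) fun z => ?_
  obtain ⟨z, rfl⟩ : ∃ w, z = vec w := ⟨z.ofLp, rfl⟩
  let p : EuclideanSpace ℝ (Fin n) := WithLp.toLp 2 fun i => (z i).re
  let q : EuclideanSpace ℝ (Fin n) := WithLp.toLp 2 fun i => (z i).im
  have hp := (Matrix.toEuclideanCLM (n := Fin n) (𝕜 := ℝ) A).le_opNorm p
  have hq := (Matrix.toEuclideanCLM (n := Fin n) (𝕜 := ℝ) A).le_opNorm q
  have hp2 := pow_le_pow_left₀ (norm_nonneg _) hp 2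
  have hq2 := pow_le_pow_left₀ (norm_nonneg _) hq 2
  have hz : ‖vec z‖ ^ 2 = ‖p‖ ^ 2 + ‖q‖ ^ 2 := by
    rw [norm_vec_sq, EuclideanSpace.norm_sq_eq, EuclideanSpace.norm_sq_eq,
      ← Finset.sum_add_distrib]
    refine Finset.sum_congr rfl fun i _ => ?_
    rw [← Complex.normSq_eq_norm_sq, Complex.normSq_apply]
    simp [p, q, sq]
  have hAz : ‖op A (vec z)‖ ^ 2 = ‖Matrix.toEuclideanCLM (n := Fin n) (𝕜 := ℝ) A p‖ ^ 2 +
      ‖Matrix.toEuclideanCLM (n := Fin n) (𝕜 := ℝ) A q‖ ^ 2 := by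
    rw [op_vec, norm_vec_sq, EuclideanSpace.norm_sq_eq, EuclideanSpace.norm_sq_eq,
      ← Finset.sum_add_distrib]
    refine Finset.sum_congr rfl fun i _ => ?_
    rw [← Complex.normSq_eq_norm_sq, Complex.normSq_apply]
    simp [p, q, sq, Matrix.mulVec, dotProduct, toC]
  refine (abs_le_of_sq_le_sq' ?_ (mul_nonneg (twoNorm_nonneg A) (norm_nonneg _))).2
  rw [hAz, mul_pow, hz]
  unfold twoNorm
  nlinarith

/-! ### The real rank-one matrix -/

/-- Conjugate eigenvalues yield the same input for the linear problem; this is why uniqueness up to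
conjugation suffices. -/
theorem reOuter_star (x y : Fin n → ℂ) : reOuter (star x) (star y) = reOuter x y := by
  ext i j; simp [reOuter]

theorem frobNorm_reOuter_le (x y : Fin n → ℂ) : frobNorm (reOuter x y) ≤ ‖vec x‖ * ‖vec y‖ := by
  refine (abs_le_of_sq_le_sq' ?_ (mul_nonneg (norm_nonneg _) (norm_nonneg _))).2
  rw [mul_pow, norm_vec_sq, norm_vec_sq, frobNorm_sq, mul_comm, Finset.sum_mul_sum,
    Fintype.sum_prod_type]
  refine Finset.sum_le_sum fun i _ => Finset.sum_le_sum fun j _ => ?_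
  rw [← mul_pow, ← sq_abs]
  refine pow_le_pow_left₀ (abs_nonneg _) ?_ 2
  refine (Complex.abs_re_le_norm _).trans (le_of_eq ?_)
  rw [norm_mul, norm_star]

/-- This identifies the linear objective with the real part of the first-order term `y^* D x` of the
eigenvalue expansion. -/
theorem matInner_reOuter (D : Matrix (Fin n) (Fin n) ℝ) (x y : Fin n → ℂ) :
    matInner D (reOuter x y) = (inner ℂ (vec y) (op D (vec x))).re := by
  rw [op_vec, inner_vec, matInner_eq_sum, Fintype.sum_prod_type, dotProduct, Complex.re_sum]
  refine Finset.sum_congr rfl fun i _ => ?_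
  rw [Matrix.mulVec, dotProduct, Finset.mul_sum, Complex.re_sum]
  refine Finset.sum_congr rfl fun j _ => ?_
  simp [reOuter, toC]
  ring

/-- Telescoping `v u^* - y x^*` through `b y u^*` and `b ā y x^*`. In use, `a` and `b` are the
components of `u` along `x` and of `v` along `y`, so the last two terms are the tails. -/
theorem frobNorm_reOuter_sub_le {x y u v : Fin n → ℂ} (hx : ‖vec x‖ = 1) (hy : ‖vec y‖ = 1)
    (hu : ‖vec u‖ = 1) (a b : ℂ) (hb : ‖b‖ ≤ 1) :
    frobNorm (reOuter u v - reOuter x y) ≤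
      ‖conj b * a - 1‖ + ‖vec u - a • vec x‖ + ‖vec v - b • vec y‖ := by
  have hdec : reOuter u v - reOuter x y =
      reOuter x ((b * conj a - 1) • y) + reOuter (u - a • x) (b • y) + reOuter u (v - b • y) := by
    ext i j
    simp [reOuter]
    ring
  rw [hdec]
  refine (frobNorm_add_le _ _).trans (add_le_add ((frobNorm_add_le _ _).trans (add_le_add ?_ ?_)) ?_)
  · refine (frobNorm_reOuter_le _ _).trans (le_of_eq ?_)
    rw [vec_smul, norm_smul, hx, hy, one_mul, mul_one, ← RCLike.norm_conj]
    simp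
  · refine (frobNorm_reOuter_le _ _).trans ?_
    rw [vec_smul, norm_smul, hy, mul_one, vec_sub, vec_smul]
    exact mul_le_of_le_one_right (norm_nonneg _) hb
  · refine (frobNorm_reOuter_le _ _).trans (le_of_eq ?_)
    rw [hu, one_mul, vec_sub, vec_smul]

/-! ### Eigenvalues of real matrices -/

theorem mem_spectrum_iff_det {N : Matrix (Fin n) (Fin n) ℂ} {μ : ℂ} :
    μ ∈ spectrum ℂ N ↔ (Matrix.scalar (Fin n) μ - N).det = 0 := by
  rw [Matrix.mem_spectrum_iff_isRoot_charpoly, Polynomial.IsRoot, Matrix.eval_charpoly]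

theorem exists_unit_smul {w : Fin n → ℂ} (hw : w ≠ 0) : ∃ c : ℂ, ‖vec (c • w)‖ = 1 := by
  have h : ‖vec w‖ ≠ 0 := fun h => hw (vec_injective (norm_eq_zero.1 h))
  refine ⟨((‖vec w‖⁻¹ : ℝ) : ℂ), ?_⟩
  rw [vec_smul, norm_smul, Complex.norm_real, norm_inv, norm_norm, inv_mul_cancel₀ h]

theorem exists_right_eigenvector {N : Matrix (Fin n) (Fin n) ℂ} {μ : ℂ} (h : μ ∈ spectrum ℂ N) :
    ∃ u, ‖vec u‖ = 1 ∧ N *ᵥ u = μ • u := by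
  obtain ⟨w, hw, h0⟩ := Matrix.exists_mulVec_eq_zero_iff.2 (mem_spectrum_iff_det.1 h)
  rw [Matrix.sub_mulVec, sub_eq_zero] at h0
  obtain ⟨c, hc⟩ := exists_unit_smul hw
  refine ⟨c • w, hc, ?_⟩
  rw [Matrix.mulVec_smul, ← h0, smul_comm]
  simp

theorem exists_left_eigenvector {N : Matrix (Fin n) (Fin n) ℂ} {μ : ℂ} (h : μ ∈ spectrum ℂ N) :
    ∃ v, ‖vec v‖ = 1 ∧ star v ᵥ* N = μ • star v := by
  obtain ⟨w, hw, h0⟩ := Matrix.exists_vecMul_eq_zero_iff.2 (mem_spectrum_iff_det.1 h)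
  rw [Matrix.vecMul_sub, sub_eq_zero] at h0
  obtain ⟨c, hc⟩ := exists_unit_smul hw
  refine ⟨star (c • w), by rw [norm_vec_star, hc], ?_⟩
  rw [star_star, Matrix.smul_vecMul, ← h0, smul_comm]
  simp

theorem mem_spectrum_of_mulVec {N : Matrix (Fin n) (Fin n) ℂ} {μ : ℂ} {u : Fin n → ℂ}
    (hu : u ≠ 0) (h : N *ᵥ u = μ • u) : μ ∈ spectrum ℂ N := by
  refine mem_spectrum_iff_det.2 (Matrix.exists_mulVec_eq_zero_iff.1 ⟨u, hu, ?_⟩)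
  rw [Matrix.sub_mulVec, h]
  simp

theorem ne_zero_of_norm_vec {u : Fin n → ℂ} (h : ‖vec u‖ = 1) : u ≠ 0 := by
  rintro rfl
  have : vec (0 : Fin n → ℂ) = 0 := rfl
  rw [this, norm_zero] at h
  exact zero_ne_one h

theorem toC_mulVec_star (A : Matrix (Fin n) (Fin n) ℝ) (u : Fin n → ℂ) :
    toC A *ᵥ star u = star (toC A *ᵥ u) := by
  ext i
  simp [Matrix.mulVec, dotProduct, toC]

theorem star_vecMul_toC (A : Matrix (Fin n) (Fin n) ℝ) (u : Fin n → ℂ) :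
    star u ᵥ* toC A = star (u ᵥ* toC A) := by
  ext i
  simp [Matrix.vecMul, dotProduct, toC]

theorem star_mem_spectrum {A : Matrix (Fin n) (Fin n) ℝ} {μ : ℂ} (h : μ ∈ spectrum ℂ (toC A)) :
    star μ ∈ spectrum ℂ (toC A) := by
  obtain ⟨u, hu, hN⟩ := exists_right_eigenvector h
  refine mem_spectrum_of_mulVec (u := star u) (fun h0 => ne_zero_of_norm_vec hu ?_) ?_
  · rw [← star_star u, h0, star_zero]
  · rw [toC_mulVec_star, hN, star_smul]

theorem IsRightmost.starred {A : Matrix (Fin n) (Fin n) ℝ} {μ : ℂ} (h : IsRightmost A μ) :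
    IsRightmost A (star μ) :=
  ⟨star_mem_spectrum h.1, by simpa using h.2⟩

theorem RPCompatible.starred {x y : Fin n → ℂ} (h : RPCompatible x y) :
    RPCompatible (star x) (star y) := by
  obtain ⟨h1, h2, h3, h4⟩ := h
  have key : ∀ a b : Fin n → ℂ, star (star a) ⬝ᵥ star b =
      star (star a ⬝ᵥ b) := fun a b => by
    rw [Matrix.star_dotProduct_star, dotProduct_comm, ← Matrix.star_dotProduct]
  refine ⟨by rw [key, h1, star_one], by rw [key, h2, star_one], ?_, ?_⟩
  · rw [key, RCLike.star_def, Complex.conj_im, h3, neg_zero]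
  · rw [key, RCLike.star_def, Complex.conj_re]; exact h4

theorem IsRPEigenpair.starred {A : Matrix (Fin n) (Fin n) ℝ} {μ : ℂ} {x y : Fin n → ℂ}
    (h : IsRPEigenpair A μ x y) : IsRPEigenpair A (star μ) (star x) (star y) := by
  obtain ⟨h1, h2, h3⟩ := h
  refine ⟨by rw [toC_mulVec_star, h1, star_smul], ?_, h3.starred⟩
  rw [star_vecMul_toC, h2, star_smul]

theorem IsRPEigenpair.norm_left {A : Matrix (Fin n) (Fin n) ℝ} {μ : ℂ} {x y : Fin n → ℂ}
    (h : IsRPEigenpair A μ x y) : ‖vec x‖ = 1 := norm_vec_eq_one.2 h.2.2.1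

theorem IsRPEigenpair.norm_right {A : Matrix (Fin n) (Fin n) ℝ} {μ : ℂ} {x y : Fin n → ℂ}
    (h : IsRPEigenpair A μ x y) : ‖vec y‖ = 1 := norm_vec_eq_one.2 h.2.2.2.1

theorem IsRPEigenpair.inner_im {A : Matrix (Fin n) (Fin n) ℝ} {μ : ℂ} {x y : Fin n → ℂ}
    (h : IsRPEigenpair A μ x y) : (inner ℂ (vec y) (vec x)).im = 0 := by
  rw [← inner_conj_symm, inner_vec, Complex.conj_im, h.2.2.2.2.1, neg_zero]

theorem IsRPEigenpair.inner_re {A : Matrix (Fin n) (Fin n) ℝ} {μ : ℂ} {x y : Fin n → ℂ}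
    (h : IsRPEigenpair A μ x y) : 0 < (inner ℂ (vec y) (vec x)).re := by
  rw [← inner_conj_symm, inner_vec, Complex.conj_re]
  exact h.2.2.2.2.2

theorem IsRPEigenpair.frobNorm_le {A : Matrix (Fin n) (Fin n) ℝ} {μ : ℂ} {x y : Fin n → ℂ}
    (h : IsRPEigenpair A μ x y) : frobNorm (reOuter x y) ≤ 1 := by
  simpa [h.norm_left, h.norm_right] using frobNorm_reOuter_le x y

/-- Unit right and left eigenvectors that are not orthogonal can be made RP-compatible. -/
theorem exists_isRPEigenpair {A : Matrix (Fin n) (Fin n) ℝ} {μ : ℂ} {u v : Fin n → ℂ}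
    (hu : ‖vec u‖ = 1) (hv : ‖vec v‖ = 1) (hA : toC A *ᵥ u = μ • u)
    (hA' : star v ᵥ* toC A = μ • star v) (hne : inner ℂ (vec v) (vec u) ≠ 0) :
    ∃ u v, IsRPEigenpair A μ u v := by
  set g := inner ℂ (vec v) (vec u) with hg
  have hg0 : (‖g‖ : ℂ) ≠ 0 := by exact_mod_cast norm_ne_zero_iff.2 hne
  have hn : ‖g / ‖g‖‖ = 1 := by
    rw [norm_div, Complex.norm_real, norm_norm, div_self (norm_ne_zero_iff.2 hne)]
  have hin : star u ⬝ᵥ ((g / ‖g‖) • v) = ‖g‖ := by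
    rw [dotProduct_smul, ← inner_vec, ← inner_conj_symm, ← hg, smul_eq_mul, div_mul_eq_mul_div,
      Complex.mul_conj, Complex.normSq_eq_norm_sq, div_eq_iff hg0]
    push_cast; ring
  refine ⟨u, (g / ‖g‖) • v, hA, ?_, norm_vec_eq_one.1 hu, norm_vec_eq_one.1 ?_, ?_, ?_⟩
  · rw [star_smul, Matrix.smul_vecMul, hA', smul_comm]
  · rw [vec_smul, norm_smul, hn, hv, one_mul]
  · rw [hin, Complex.ofReal_im]
  · rw [hin, Complex.ofReal_re]; exact norm_pos_iff.2 hne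

theorem re_le_abscissa {A : Matrix (Fin n) (Fin n) ℝ} {μ : ℂ} (h : μ ∈ spectrum ℂ (toC A)) :
    μ.re ≤ abscissa A :=
  le_csSup ((Matrix.finite_spectrum (toC A)).image _).bddAbove ⟨μ, h, rfl⟩

theorem structAbscissa_eq {A : Matrix (Fin n) (Fin n) ℝ} {S : PertStructure n} {ε : ℝ}
    {D : Matrix (Fin n) (Fin n) ℝ} (hD : IsWorstCase A S ε D) {lam : ℂ}
    (hlam : IsRightmost (A + D) lam) : structAbscissa A S ε = lam.re := by
  refine IsGreatest.csSup_eq ⟨⟨lam, ⟨D, hD.1, hlam.1⟩, rfl⟩, ?_⟩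
  rintro _ ⟨z, ⟨D', hD', hz⟩, rfl⟩
  rw [hlam.2]
  exact (re_le_abscissa hz).trans (hD.2 D' hD')

theorem pow_card_le_prod_norm {s : Multiset ℂ} {lam : ℂ} {m : ℝ} (hm : 0 ≤ m)
    (h : ∀ r ∈ s, m ≤ ‖lam - r‖) : m ^ s.card ≤ ‖(s.map fun r => lam - r).prod‖ := by
  induction s using Multiset.induction with
  | empty => simp
  | cons a s ih =>
    rw [Multiset.card_cons, pow_succ', Multiset.map_cons, Multiset.prod_cons, norm_mul]
    exact mul_le_mul (h a (Multiset.mem_cons_self a s))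
      (ih fun r hr => h r (Multiset.mem_cons_of_mem hr)) (pow_nonneg hm _) (norm_nonneg _)

/-- The determinant is the product of the distances from `lam` to the `n` eigenvalues, so one of
them is small if the determinant is. Continuity of eigenvalues follows without complex analysis. -/
theorem exists_eigenvalue_near {N : Matrix (Fin n) (Fin n) ℂ} {lam : ℂ} {m : ℝ} (hm : 0 < m)
    (h : ‖(Matrix.scalar (Fin n) lam - N).det‖ < m ^ n) : ∃ μ ∈ spectrum ℂ N, ‖μ - lam‖ < m := by
  by_contra! hc
  have h1 := pow_card_le_prod_norm (s := N.charpoly.roots) (lam := lam) hm.le fun r hr => by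
    rw [norm_sub_rev]
    exact hc r (Matrix.mem_spectrum_iff_isRoot_charpoly.2 (Polynomial.isRoot_of_mem_roots hr))
  have hs := IsAlgClosed.splits N.charpoly
  rw [← hs.eval_eq_prod_roots_of_monic N.charpoly_monic, Matrix.eval_charpoly,
    ← hs.natDegree_eq_card_roots, Matrix.charpoly_natDegree_eq_dim, Fintype.card_fin] at h1
  exact absurd h (not_lt.2 h1)

theorem continuous_toC : Continuous (toC (n := n)) := by
  unfold toC
  exact continuous_id.matrix_map Complex.continuous_ofReal

theorem continuous_det_scalar_sub (A : Matrix (Fin n) (Fin n) ℝ) :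
    Continuous fun q : ℂ × Matrix (Fin n) (Fin n) ℝ =>
      (Matrix.scalar (Fin n) q.1 - toC (A + q.2)).det := by
  refine Continuous.matrix_det (Continuous.sub ?_ ?_)
  · simp only [Matrix.scalar_apply]
    exact Continuous.matrix_diagonal (continuous_pi fun _ => continuous_fst)
  · exact continuous_toC.comp (continuous_const.add continuous_snd)

/-- An eigenvalue persists under small perturbations. -/
theorem eventually_exists_eigenvalue_near {A D : Matrix (Fin n) (Fin n) ℝ} {lam : ℂ}
    (h : lam ∈ spectrum ℂ (toC (A + D))) {η : ℝ} (hη : 0 < η) :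
    ∀ᶠ D' in 𝓝 D, ∃ μ ∈ spectrum ℂ (toC (A + D')), ‖μ - lam‖ < η := by
  have hc : Continuous fun D' => ‖(Matrix.scalar (Fin n) lam - toC (A + D')).det‖ :=
    ((continuous_det_scalar_sub A).comp (Continuous.prodMk_right lam)).norm
  have h0 : ‖(Matrix.scalar (Fin n) lam - toC (A + D)).det‖ < η ^ n := by
    rw [mem_spectrum_iff_det.1 h, norm_zero]; positivity
  filter_upwards [(hc.tendsto D).eventually (gt_mem_nhds h0)] with D' hD'
  exact exists_eigenvalue_near hη hD'

theorem norm_le_frobNorm_of_mem_spectrum {A : Matrix (Fin n) (Fin n) ℝ} {μ : ℂ}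
    (h : μ ∈ spectrum ℂ (toC A)) : ‖μ‖ ≤ frobNorm A := by
  obtain ⟨u, hu, hN⟩ := exists_right_eigenvector h
  have h1 := (op A).le_opNorm (vec u)
  rw [op_vec, hN, vec_smul, norm_smul, hu, mul_one, mul_one] at h1
  exact h1.trans ((norm_op_le_twoNorm A).trans (twoNorm_le_frobNorm A))

/-- Rightmost eigenvalues of nearby matrices are near rightmost eigenvalues. -/
theorem eventually_rightmost_near {A D : Matrix (Fin n) (Fin n) ℝ} {lam : ℂ}
    (hlam : IsRightmost (A + D) lam)
    (huniq : ∀ μ, IsRightmost (A + D) μ → μ = lam ∨ μ = star lam) {η : ℝ} (hη : 0 < η) :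
    ∀ᶠ D' in 𝓝 D, ∀ μ, IsRightmost (A + D') μ → ‖μ - lam‖ < η ∨ ‖μ - star lam‖ < η := by
  by_contra hcon
  have : FirstCountableTopology (Matrix (Fin n) (Fin n) ℝ) :=
    inferInstanceAs (FirstCountableTopology (Fin n → Fin n → ℝ))
  obtain ⟨Ds, hDs, hbad⟩ := exists_seq_forall_of_frequently (not_eventually.1 hcon)
  simp only [not_forall, not_or, not_lt] at hbad
  choose μ hμ hfar using hbad
  have hfrob : Continuous fun D' : Matrix (Fin n) (Fin n) ℝ => frobNorm (A + D') := by
    unfold frobNorm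
    fun_prop
  have hbd : ∀ᶠ k in atTop, ‖μ k‖ ≤ frobNorm (A + D) + 1 := by
    filter_upwards [((hfrob.tendsto D).comp hDs).eventually
      (gt_mem_nhds (lt_add_one (frobNorm (A + D))))] with k hk
    exact (norm_le_frobNorm_of_mem_spectrum (hμ k).1).trans hk.le
  -- A limit point of rightmost eigenvalues staying away from `lam` and `star lam`; it is an
  -- eigenvalue of the limit matrix by continuity of the determinant.
  obtain ⟨μ', -, φ, hφ, hlim⟩ := tendsto_subseq_of_frequently_bounded
    (Metric.isBounded_closedBall (x := (0 : ℂ)) (r := frobNorm (A + D) + 1))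
    (x := μ) (hbd.frequently.mono fun k hk => by simpa using hk)
  have hDφ := hDs.comp hφ.tendsto_atTop
  have hspec : μ' ∈ spectrum ℂ (toC (A + D)) := by
    rw [mem_spectrum_iff_det]
    have h1 := ((continuous_det_scalar_sub A).tendsto (μ', D)).comp (hlim.prodMk_nhds hDφ)
    refine tendsto_nhds_unique h1 ?_
    refine tendsto_const_nhds.congr fun k => ?_
    exact (mem_spectrum_iff_det.1 (hμ (φ k)).1).symm
  -- `lam` persists under small perturbations, so the rightmost eigenvalues cannot end up to the
  -- left of it.
  have hre : lam.re ≤ μ'.re := by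
    refine le_of_forall_pos_le_add fun κ hκ => ?_
    have h2 : Tendsto (fun k => (μ (φ k)).re + κ) atTop (𝓝 (μ'.re + κ)) :=
      ((Complex.continuous_re.tendsto μ').comp hlim).add_const κ
    refine ge_of_tendsto h2 ?_
    filter_upwards [hDφ.eventually (eventually_exists_eigenvalue_near hlam.1 hκ)] with k hk
    obtain ⟨ν, hν, hd⟩ := hk
    have h3 := re_le_abscissa hν
    rw [Function.comp_apply, ← (hμ (φ k)).2] at h3
    have h4 := (abs_le.1 (Complex.abs_re_le_norm (ν - lam))).1
    rw [Complex.sub_re] at h4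
    linarith
  have hright : IsRightmost (A + D) μ' :=
    ⟨hspec, le_antisymm (re_le_abscissa hspec) (hlam.2 ▸ hre)⟩
  rcases huniq μ' hright with rfl | rfl
  · have h1 : Tendsto (fun k => ‖μ (φ k) - μ'‖) atTop (𝓝 0) :=
      tendsto_iff_norm_sub_tendsto_zero.1 hlim
    exact absurd (ge_of_tendsto' h1 fun k => (hfar (φ k)).1) (not_le.2 hη)
  · have h1 : Tendsto (fun k => ‖μ (φ k) - star lam‖) atTop (𝓝 0) :=
      tendsto_iff_norm_sub_tendsto_zero.1 hlim
    exact absurd (ge_of_tendsto' h1 fun k => (hfar (φ k)).2) (not_le.2 hη)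

end StructuredPseudospectrum

/-! ### Lower bounds on the complement of an eigenvector, from singular values and from simplicity.
-/

namespace StructuredPseudospectrum

open ComplexConjugate Filter Topology

section SingularValues

variable {V : Type*} [NormedAddCommGroup V] [InnerProductSpace ℂ V]

/-- A lower bound on a hyperplane passes to the orthogonal complement of the kernel. -/
theorem lower_bound_orthogonal {B : V →ₗ[ℂ] V} {f x : V} {s : ℝ} (hs : 0 < s)
    (hf : ∀ w, inner ℂ f w = 0 → s * ‖w‖ ≤ ‖B w‖) (hx : ‖x‖ = 1) (hB : B x = 0) {z : V}
    (hz : inner ℂ x z = 0) : s * ‖z‖ ≤ ‖B z‖ := by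
  have hfx : inner ℂ f x ≠ 0 := fun h => by
    have := hf x h
    rw [hx, hB, norm_zero] at this
    linarith
  -- Subtracting a multiple of the kernel vector `x` moves `z` into the hyperplane without changing
  -- its image, and does not shorten it because `z` is orthogonal to `x`.
  set β := inner ℂ f z / inner ℂ f x with hβ
  have h1 := hf (z - β • x) (by
    rw [inner_sub_right, inner_smul_right, hβ, div_mul_cancel₀ _ hfx, sub_self])
  rw [map_sub, map_smul, hB, smul_zero, sub_zero] at h1
  refine le_trans (mul_le_mul_of_nonneg_left ?_ hs.le) h1
  have h2 := norm_sq_eq_add_of_unit hx (z - β • x)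
  have h3 : inner ℂ x (z - β • x) = -β := by
    rw [inner_sub_right, hz, inner_smul_right, inner_self_eq_norm_sq_to_K, hx]
    simp
  rw [h3, neg_smul, sub_neg_eq_add, sub_add_cancel] at h2
  exact (abs_le_of_sq_le_sq' (by nlinarith [sq_nonneg ‖-β‖]) (norm_nonneg _)).2

variable [FiniteDimensional ℂ V]

/-- An operator is bounded below by its second smallest singular value on a hyperplane. -/
theorem exists_hyperplane_singularValue_le {n : ℕ} (hn : Module.finrank ℂ V = n) (hn2 : 2 ≤ n)
    (T : V →ₗ[ℂ] V) :
    ∃ f : V, ∀ w, inner ℂ f w = 0 → T.singularValues (n - 2) * ‖w‖ ≤ ‖T w‖ := by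
  have hS := T.isSymmetric_adjoint_comp_self
  let b := hS.eigenvectorBasis hn
  -- The eigenvalues of `T^* T` are listed in non-increasing order from index `0`. Removing the last
  -- eigenvector leaves eigenvalues at least the one of index `n - 2`.
  let i₀ : Fin n := ⟨n - 1, by omega⟩
  refine ⟨b i₀, fun w hw => ?_⟩
  refine (abs_le_of_sq_le_sq' ?_ (norm_nonneg _)).2
  have h1 : ‖T w‖ ^ 2 = ∑ i, hS.eigenvalues hn i * ‖inner ℂ (b i) w‖ ^ 2 := by
    have h2 : inner ℂ w ((LinearMap.adjoint T ∘ₗ T) w) = ((‖T w‖ ^ 2 : ℝ) : ℂ) := by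
      rw [LinearMap.comp_apply, LinearMap.adjoint_inner_right, inner_self_eq_norm_sq_to_K]
      simp
    have h3 : ∀ i, inner ℂ w (b i) * inner ℂ (b i) ((LinearMap.adjoint T ∘ₗ T) w) =
        ((hS.eigenvalues hn i * ‖inner ℂ (b i) w‖ ^ 2 : ℝ) : ℂ) := fun i => by
      rw [← hS (b i) w, hS.apply_eigenvectorBasis hn i, inner_smul_left, ← inner_conj_symm w]
      have h4 := Complex.normSq_eq_conj_mul_self (z := inner ℂ (b i) w)
      rw [Complex.normSq_eq_norm_sq] at h4
      push_cast at h4 ⊢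
      rw [h4]
      simp [b]
      ring
    rw [← b.sum_inner_mul_inner, Finset.sum_congr rfl fun i _ => h3 i] at h2
    exact_mod_cast h2.symm
  rw [mul_pow, h1, ← b.sum_sq_norm_inner_right w, Finset.mul_sum,
    T.sq_singularValues_of_lt hn (show n - 2 < n by omega)]
  refine Finset.sum_le_sum fun i _ => ?_
  by_cases hi : i = i₀
  · subst hi; rw [hw]; simp
  · refine mul_le_mul_of_nonneg_right (hS.eigenvalues_antitone hn ?_) (sq_nonneg _)
    have : (i : ℕ) ≠ n - 1 := fun h => hi (Fin.ext h)
    have := i.2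
    rw [Fin.le_def]
    change (i : ℕ) ≤ n - 2
    omega

end SingularValues

variable {n : ℕ} {A Dopt : Matrix (Fin n) (Fin n) ℝ} {lam μ : ℂ} {x y : Fin n → ℂ}

theorem IsRPEigenpair.isSimplePair (h : IsRPEigenpair A lam x y) {s : ℝ} (hs : 0 < s)
    (hlow : ∀ z, inner ℂ (vec x) z = 0 → s * ‖z‖ ≤ ‖op A z - lam • z‖) :
    IsSimplePair (op A) lam (vec x) (vec y) (star y ⬝ᵥ x).re s where
  right := by rw [op_vec, h.1, vec_smul]
  left := by rw [adjoint_op_vec, conjTranspose_mulVec_eq_of_left h.2.1, vec_smul]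
  norm_right := h.norm_left
  norm_left := h.norm_right
  inner_eq := by
    refine Complex.ext ?_ ?_
    · rw [inner_vec, Complex.ofReal_re]
    · rw [h.inner_im, Complex.ofReal_im]
  τ_pos := by rw [← inner_vec]; exact h.inner_re
  s_pos := hs
  lower := hlow

/-- A simple eigenvalue gives a positive lower bound on the orthogonal complement of its
eigenvector. -/
theorem IsRPEigenpair.exists_isSimplePair (h : IsRPEigenpair A lam x y)
    (hsimple : (toC A).charpoly.rootMultiplicity lam = 1) :
    ∃ s, IsSimplePair (op A) lam (vec x) (vec y) (star y ⬝ᵥ x).re s := by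
  -- The geometric multiplicity is at most the algebraic one, so the eigenspace is a line.
  have hfin : Module.finrank ℂ (Module.End.eigenspace (Matrix.toLin' (toC A)) lam) ≤ 1 := by
    have := LinearMap.finrank_eigenspace_le (Matrix.toLin' (toC A)) lam
    rwa [Matrix.charpoly_toLin', hsimple] at this
  have hmem : ∀ z : Fin n → ℂ, toC A *ᵥ z = lam • z →
      z ∈ Module.End.eigenspace (Matrix.toLin' (toC A)) lam := fun z hz =>
    Module.End.mem_eigenspace_iff.2 (by rw [Matrix.toLin'_apply, hz])
  obtain ⟨g, hg⟩ := finrank_le_one_iff.1 hfin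
  obtain ⟨c, hc⟩ := hg ⟨x, hmem x h.1⟩
  have hx := ne_zero_of_norm_vec h.norm_left
  have hc0 : c ≠ 0 := by
    rintro rfl
    exact hx (by simpa using (congrArg Subtype.val hc).symm)
  let f : (ℂ ∙ vec x)ᗮ →ₗ[ℂ] EuclideanSpace ℂ (Fin n) :=
    ((op A : _ →ₗ[ℂ] EuclideanSpace ℂ (Fin n)) - lam • LinearMap.id).comp
      (ℂ ∙ vec x)ᗮ.subtype
  have hker : f.ker = ⊥ := by
    refine LinearMap.ker_eq_bot'.2 fun z hz => ?_
    have hz1 : op A (z : EuclideanSpace ℂ (Fin n)) = lam • (z : EuclideanSpace ℂ (Fin n)) :=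
      sub_eq_zero.1 hz
    have hz2 : toC A *ᵥ (z : EuclideanSpace ℂ (Fin n)).ofLp =
        lam • (z : EuclideanSpace ℂ (Fin n)).ofLp := congrArg WithLp.ofLp hz1
    obtain ⟨d, hd⟩ := hg ⟨_, hmem _ hz2⟩
    have hzx : (z : EuclideanSpace ℂ (Fin n)) = (d * c⁻¹) • vec x := by
      have h1 : c • (g : Fin n → ℂ) = x := congrArg Subtype.val hc
      have h2 : d • (g : Fin n → ℂ) = (z : EuclideanSpace ℂ (Fin n)).ofLp :=
        congrArg Subtype.val hd
      have h3 : (z : EuclideanSpace ℂ (Fin n)) = vec (d • (g : Fin n → ℂ)) := by rw [h2]; rfl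
      rw [h3, ← h1, ← vec_smul, smul_smul, inv_mul_cancel_right₀ hc0]
    have horth := Submodule.mem_orthogonal_singleton_iff_inner_right.1 z.2
    rw [hzx, inner_smul_right, inner_self_eq_norm_sq_to_K, h.norm_left] at horth
    have hd0 : d * c⁻¹ = 0 := by simpa using horth
    exact Subtype.ext (by rw [hzx, hd0, zero_smul]; rfl)
  obtain ⟨K, hK, hanti⟩ := LinearMap.exists_antilipschitzWith f hker
  refine ⟨(K : ℝ)⁻¹, h.isSimplePair (by positivity) fun z hz => ?_⟩
  have h1 := hanti.le_mul_norm_sub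
    (⟨z, Submodule.mem_orthogonal_singleton_iff_inner_right.2 hz⟩ : (ℂ ∙ vec x)ᗮ) 0
  rw [map_zero, add_zero, add_zero, norm_neg, norm_neg] at h1
  rw [inv_mul_le_iff₀ (by exact_mod_cast hK)]
  exact h1

theorem toEuclideanLin_sub_smul_apply (A : Matrix (Fin n) (Fin n) ℝ) (lam : ℂ)
    (w : EuclideanSpace ℂ (Fin n)) :
    Matrix.toEuclideanLin (toC A - lam • (1 : Matrix (Fin n) (Fin n) ℂ)) w = op A w - lam • w := by
  rw [map_sub, map_smul, Matrix.toLpLin_one]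
  rfl

theorem exists_hyperplane_secondSmallest_le (hn : 2 ≤ n) (A : Matrix (Fin n) (Fin n) ℝ)
    (lam : ℂ) : ∃ f : EuclideanSpace ℂ (Fin n), ∀ w, inner ℂ f w = 0 →
      secondSmallestSingularValue (toC A - lam • (1 : Matrix (Fin n) (Fin n) ℂ)) * ‖w‖ ≤
        ‖op A w - lam • w‖ := by
  obtain ⟨f, hf⟩ := exists_hyperplane_singularValue_le (n := n) finrank_euclideanSpace_fin hn
    (Matrix.toEuclideanLin (toC A - lam • (1 : Matrix (Fin n) (Fin n) ℂ)))
  refine ⟨f, fun w hw => ?_⟩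
  rw [← toEuclideanLin_sub_smul_apply]
  exact hf w hw

/-- The lower bound from the second smallest singular value of the unperturbed matrix. -/
theorem IsRPEigenpair.isSimplePair_of_singularValue (hn : 2 ≤ n)
    (h : IsRPEigenpair (A + Dopt) lam x y) {ε : ℝ} (hD : frobNorm Dopt ≤ ε)
    (hσ : ε < secondSmallestSingularValue (toC A - lam • (1 : Matrix (Fin n) (Fin n) ℂ))) :
    IsSimplePair (op (A + Dopt)) lam (vec x) (vec y) (star y ⬝ᵥ x).re
      (secondSmallestSingularValue (toC A - lam • (1 : Matrix (Fin n) (Fin n) ℂ)) - ε) := by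
  obtain ⟨f, hf⟩ := exists_hyperplane_secondSmallest_le hn A lam
  generalize secondSmallestSingularValue (toC A - lam • (1 : Matrix (Fin n) (Fin n) ℂ)) = σ
    at hσ hf ⊢
  refine h.isSimplePair (sub_pos.2 hσ) fun z hz => ?_
  let B : EuclideanSpace ℂ (Fin n) →ₗ[ℂ] EuclideanSpace ℂ (Fin n) :=
    (op (A + Dopt) : _ →ₗ[ℂ] EuclideanSpace ℂ (Fin n)) - lam • LinearMap.id
  have hB : ∀ w, B w = op (A + Dopt) w - lam • w := fun w => rfl
  -- Perturbing by `Dopt` costs at most `ε` on the hyperplane; only afterwards is the bound moved to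
  -- the complement of `x`, where `A + Dopt`, unlike `A`, has the required kernel.
  have hBf : ∀ w, inner ℂ f w = 0 → (σ - ε) * ‖w‖ ≤ ‖B w‖ := fun w hw => by
    have h1 := hf w hw
    have h2 : op (A + Dopt) w - lam • w = (op A w - lam • w) + op Dopt w := by
      rw [op_add, add_apply]; abel
    have h3 : ‖op Dopt w‖ ≤ ε * ‖w‖ :=
      ((op Dopt).le_opNorm w).trans (mul_le_mul_of_nonneg_right
        (((norm_op_le_twoNorm _).trans (twoNorm_le_frobNorm _)).trans hD) (norm_nonneg _))
    have h4 := norm_sub_norm_le (op A w - lam • w) (-op Dopt w)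
    rw [norm_neg, sub_neg_eq_add, ← h2] at h4
    rw [hB, sub_mul]
    linarith
  have hBx : B (vec x) = 0 := by rw [hB, op_vec, h.1, vec_smul, sub_self]
  rw [← hB]
  exact lower_bound_orthogonal (sub_pos.2 hσ) hBf h.norm_left hBx hz

/-! ### First-order optimality of `Dopt` and behaviour of rightmost eigenvalues near it. -/

theorem op_add_op_sub_apply {D : Matrix (Fin n) (Fin n) ℝ} {u : Fin n → ℂ}
    (hu : toC (A + D) *ᵥ u = μ • u) :
    op (A + Dopt) (vec u) + op (D - Dopt) (vec u) = μ • vec u := by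
  rw [← add_apply, ← op_add, add_add_sub_cancel, op_vec, hu, vec_smul]

theorem adjoint_op_add_apply {D : Matrix (Fin n) (Fin n) ℝ} {v : Fin n → ℂ}
    (hv : star v ᵥ* toC (A + D) = μ • star v) :
    ContinuousLinearMap.adjoint (op (A + Dopt)) (vec v) +
      ContinuousLinearMap.adjoint (op (D - Dopt)) (vec v) = conj μ • vec v := by
  rw [← add_apply, ← map_add, ← op_add, add_add_sub_cancel, adjoint_op_vec,
    conjTranspose_mulVec_eq_of_left hv, vec_smul]

/-- A worst-case perturbation maximizes the linearization of the spectral abscissa. -/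
theorem IsWorstCase.isOptimizer {S : PertStructure n} {ε τ s : ℝ} (hD : IsWorstCase A S ε Dopt)
    (hlam : IsRightmost (A + Dopt) lam)
    (hp : IsSimplePair (op (A + Dopt)) lam (vec x) (vec y) τ s) :
    IsOptimizer S ε (reOuter x y) Dopt := by
  refine ⟨hD.1, fun D' hD' => ?_⟩
  by_contra! hlt
  have hτ := hp.τ_pos
  have hs := hp.s_pos
  have hg : 0 < matInner (D' - Dopt) (reOuter x y) := by rw [matInner_sub_left]; linarith
  set W := D' - Dopt with hW
  set g := matInner W (reOuter x y) with hgdef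
  set F := frobNorm W with hF
  have hF0 : 0 ≤ F := frobNorm_nonneg W
  have hlim : Tendsto (fun t : ℝ => Dopt + t • W) (𝓝[>] 0) (𝓝 Dopt) := by
    have hc : Continuous fun t : ℝ => Dopt + t • W := by fun_prop
    have := hc.tendsto 0
    simp only [zero_smul, add_zero] at this
    exact this.mono_left nhdsWithin_le_nhds
  have hsmall : ∀ (a b : ℝ), 0 < b → ∀ᶠ t in 𝓝[>] (0 : ℝ), t * a < b := fun a b hb => by
    have hc : Continuous fun t : ℝ => t * a := by fun_prop
    have := (hc.tendsto 0).eventually (gt_mem_nhds (show 0 * a < b by simpa using hb))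
    exact nhdsWithin_le_nhds this
  -- Half of the budget `s τ / 100` of the perturbation lemmas; the other half is for the norm of
  -- the perturbation.
  have hη : 0 < s * τ / 200 := by positivity
  have h01 : ∀ᶠ t in 𝓝[>] (0 : ℝ), t < 1 := nhdsWithin_le_nhds (eventually_lt_nhds one_pos)
  -- For such `t` the linear gain `t g` exceeds the quadratic error of the expansion, so the
  -- eigenvalue near `lam` moves to the right, against worst-case optimality.
  obtain ⟨t, h1, h2, h3, h4, h5⟩ := ((hlim.eventually
    (eventually_exists_eigenvalue_near hlam.1 hη)).and ((hsmall F _ hη).and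
    ((hsmall (10 / (s * τ ^ 2) * F ^ 2) g hg).and (h01.and self_mem_nhdsWithin)))).exists
  have ht : (0 : ℝ) < t := h5
  obtain ⟨μ, hμ, hd⟩ := h1
  obtain ⟨u, hu, hev⟩ := exists_right_eigenvector hμ
  have hE : op (Dopt + t • W - Dopt) = op (t • W) := by rw [add_sub_cancel_left]
  have hEn : ‖op (t • W)‖ ≤ t * F := by
    refine ((norm_op_le_twoNorm _).trans (twoNorm_le_frobNorm _)).trans (le_of_eq ?_)
    rw [frobNorm_smul, abs_of_pos ht]
  have hT := op_add_op_sub_apply (Dopt := Dopt) hev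
  rw [hE] at hT
  have hfo := hp.first_order hu hT (by linarith)
  have hre := (Complex.abs_re_le_norm _).trans hfo
  have hinner : (inner ℂ (vec y) (op (t • W) (vec x))).re = t * g := by
    rw [← matInner_reOuter, matInner_smul_left]
  rw [Complex.sub_re, hinner, Complex.re_ofReal_mul, Complex.sub_re] at hre
  have h6 := (abs_le.1 hre).1
  have h7 : 10 / (s * τ ^ 2) * ‖op (t • W)‖ ^ 2 ≤ 10 / (s * τ ^ 2) * (t * F) ^ 2 :=
    mul_le_mul_of_nonneg_left (pow_le_pow_left₀ (norm_nonneg _) hEn 2) (by positivity)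
  have h8 : 10 / (s * τ ^ 2) * (t * F) ^ 2 = t * (t * (10 / (s * τ ^ 2) * F ^ 2)) := by ring
  have h9 := mul_lt_mul_of_pos_left h3 ht
  have h10 : 0 < τ * (μ.re - lam.re) := by linarith
  have h11 := re_le_abscissa hμ
  have h12 := hD.2 _ (feasible_segment hD.1 hD' ht.le h4.le)
  rw [← hlam.2] at h12
  have h13 := (pos_iff_pos_of_mul_pos h10).1 hτ
  linarith

/-- Near `Dopt`: the rightmost eigenvalue is Lipschitz, it has RP-compatible eigenvectors, and
their real rank-one matrix is Lipschitz. -/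
theorem IsRPEigenpair.exists_near {τ s : ℝ} (hxy : IsRPEigenpair (A + Dopt) lam x y)
    (hlam : IsRightmost (A + Dopt) lam)
    (huniq : ∀ μ, IsRightmost (A + Dopt) μ → μ = lam ∨ μ = star lam)
    (hp : IsSimplePair (op (A + Dopt)) lam (vec x) (vec y) τ s) :
    ∃ ρ > 0, ∀ D, twoNorm (D - Dopt) < ρ → ∀ μ, IsRightmost (A + D) μ →
      |μ.re - lam.re| ≤ 2 / τ * twoNorm (D - Dopt) ∧
      (∃ u v, IsRPEigenpair (A + D) μ u v) ∧
      ∀ u v, IsRPEigenpair (A + D) μ u v →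
        frobNorm (reOuter u v - reOuter x y) ≤ 9 / 2 / (s * τ ^ 2) * twoNorm (D - Dopt) := by
  have hτ := hp.τ_pos
  have hs := hp.s_pos
  have hη : 0 < s * τ / 200 := by positivity
  obtain ⟨ρ, hρ, hb⟩ := exists_twoNorm_ball (eventually_rightmost_near hlam huniq hη)
  refine ⟨min ρ (s * τ / 200), lt_min hρ hη, fun D hDρ μ hμ => ?_⟩
  have hE := norm_op_le_twoNorm (D - Dopt)
  have hE2 := hDρ.trans_le (min_le_right _ _)
  have main : ∀ μ, IsRightmost (A + D) μ → ‖μ - lam‖ < s * τ / 200 →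
      |μ.re - lam.re| ≤ 2 / τ * twoNorm (D - Dopt) ∧
      (∃ u v, IsRPEigenpair (A + D) μ u v) ∧
      ∀ u v, IsRPEigenpair (A + D) μ u v →
        frobNorm (reOuter u v - reOuter x y) ≤ 9 / 2 / (s * τ ^ 2) * twoNorm (D - Dopt) := by
    intro μ hμ hd
    have hnear : ‖μ - lam‖ + ‖op (D - Dopt)‖ ≤ s * τ / 100 := by linarith
    obtain ⟨u, hu, hev⟩ := exists_right_eigenvector hμ.1
    obtain ⟨v, hv, hev'⟩ := exists_left_eigenvector hμ.1
    refine ⟨?_, ?_, fun u v huv => ?_⟩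
    · rw [← Complex.sub_re]
      refine (Complex.abs_re_le_norm _).trans
        ((hp.eigenvalue_le hu (op_add_op_sub_apply hev) hnear).trans ?_)
      exact mul_le_mul_of_nonneg_left hE (by positivity)
    · exact exists_isRPEigenpair hu hv hev hev' (hp.inner_ne_zero hu hv
        (op_add_op_sub_apply hev) (adjoint_op_add_apply hev') hnear)
    · have h1 := hp.rank_one_bound huv.norm_left huv.norm_right (op_add_op_sub_apply huv.1)
        (adjoint_op_add_apply huv.2.1) hnear huv.inner_im huv.inner_re
      have h2 : ‖inner ℂ (vec y) (vec v)‖ ≤ 1 := by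
        simpa [hxy.norm_right, huv.norm_right] using norm_inner_le_norm (𝕜 := ℂ) (vec y) (vec v)
      refine (frobNorm_reOuter_sub_le hxy.norm_left hxy.norm_right huv.norm_left _ _ h2).trans
        (h1.trans ?_)
      exact mul_le_mul_of_nonneg_left hE (by positivity)
  rcases hb D (hDρ.trans_le (min_le_left _ _)) μ hμ with hd | hd
  · exact main μ hμ hd
  -- An eigenvalue near `star lam` is conjugated; neither its real part nor the real rank-one matrix
  -- changes.
  · obtain ⟨h1, ⟨u, v, huv⟩, h3⟩ := main (star μ) hμ.starred (by
      rw [← norm_star, star_sub, star_star]; exact hd)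
    refine ⟨by simpa using h1, ⟨star u, star v, by simpa using huv.starred⟩, fun u v huv => ?_⟩
    rw [← reOuter_star u v]
    exact h3 _ _ huv.starred

end StructuredPseudospectrum

/-! ### Contraction of one step, and linear convergence. -/

namespace StructuredPseudospectrum

open Filter Topology

variable {n : ℕ} {A Dopt : Matrix (Fin n) (Fin n) ℝ} {S : PertStructure n} {ε : ℝ} {lam : ℂ}
  {x y : Fin n → ℂ}

/-- One step of the iteration from `D`: the rightmost eigenvalue has Lipschitz constant `K`, the
step can be carried out, and it contracts by the factor `r`. -/
def StepContracts (A Dopt : Matrix (Fin n) (Fin n) ℝ) (S : PertStructure n) (ε : ℝ) (lam : ℂ)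
    (K r : ℝ) (D : Matrix (Fin n) (Fin n) ℝ) : Prop :=
  ∀ μ, IsRightmost (A + D) μ →
    |μ.re - lam.re| ≤ K * twoNorm (D - Dopt) ∧ (∃ u v, IsRPEigenpair (A + D) μ u v) ∧
    ∀ u v, IsRPEigenpair (A + D) μ u v →
      ∃ t D', indexSetAlgorithm S ε (reOuter u v) = some (t, D') ∧
        frobNorm (D' - Dopt) ≤ r * twoNorm (D - Dopt)

/-- The two Lipschitz constants multiply. The parameters `q` and `s` are kept free because they are
chosen differently when the optimizer is locally constant, where `q = 0`. -/
theorem IsRPEigenpair.exists_stepContracts {τ s q r : ℝ} (hε : 0 < ε)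
    (hxy : IsRPEigenpair (A + Dopt) lam x y) (hlam : IsRightmost (A + Dopt) lam)
    (huniq : ∀ μ, IsRightmost (A + Dopt) μ → μ = lam ∨ μ = star lam)
    (hp : IsSimplePair (op (A + Dopt)) lam (vec x) (vec y) τ s)
    (hopt : IsOptimizer S ε (reOuter x y) Dopt) (hsat : NonSaturated S (reOuter x y) Dopt)
    (hq : 0 ≤ q) (hqr : q * (9 / 2 / (s * τ ^ 2)) ≤ r)
    (hsens : ∃ δ > 0, ∀ M', frobNorm M' ≤ 1 → frobNorm (M' - reOuter x y) ≤ δ →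
      ∀ D', IsOptimizer S ε M' D' → frobNorm (D' - Dopt) ≤ q * frobNorm (M' - reOuter x y)) :
    ∃ ρ > 0, ∀ D, twoNorm (D - Dopt) < ρ → StepContracts A Dopt S ε lam (2 / τ) r D := by
  have hτ := hp.τ_pos
  have hs := hp.s_pos
  obtain ⟨ρ, hρ, hnear⟩ := hxy.exists_near hlam huniq hp
  obtain ⟨δ₁, hδ₁, halg⟩ := hopt.algorithm_near hε hsat
  obtain ⟨δ₂, hδ₂, hsens⟩ := hsens
  set L := 9 / 2 / (s * τ ^ 2) with hL
  have hL0 : 0 < L := by positivity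
  refine ⟨min ρ (min δ₁ δ₂ / L), by positivity, fun D hD μ hμ => ?_⟩
  obtain ⟨h1, h2, h3⟩ := hnear D (hD.trans_le (min_le_left _ _)) μ hμ
  refine ⟨h1, h2, fun u v huv => ?_⟩
  have h4 := h3 u v huv
  have h5 : L * twoNorm (D - Dopt) ≤ min δ₁ δ₂ := by
    rw [← le_div_iff₀' hL0]
    exact (hD.trans_le (min_le_right _ _)).le
  have h6 := h4.trans h5
  obtain ⟨t, D', hal, hopt'⟩ := halg _ (h6.trans (min_le_left _ _))
  refine ⟨t, D', hal, ?_⟩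
  calc frobNorm (D' - Dopt) ≤ q * frobNorm (reOuter u v - reOuter x y) :=
        hsens _ huv.frobNorm_le (h6.trans (min_le_right _ _)) D' hopt'
    _ ≤ q * (L * twoNorm (D - Dopt)) := mul_le_mul_of_nonneg_left h4 hq
    _ = q * L * twoNorm (D - Dopt) := by ring
    _ ≤ r * twoNorm (D - Dopt) := mul_le_mul_of_nonneg_right hqr (twoNorm_nonneg _)

/-- The rate bounds the contraction factor when `1 ≤ c`; then `r < 1` also forces
`ε < σ`. -/
theorem rate_bound (hn : 2 ≤ n) {c σ τ r : ℝ} (hε : 0 < ε) (hc : 1 ≤ c) (hσ : 0 < σ) (hτ : 0 < τ)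
    (hτ1 : τ ≤ 1) (hr : r = 4 * Real.sqrt n * c * ε / (σ * τ ^ 2)) (hr1 : r < 1) :
    ε < σ ∧ c * ε * (9 / 2 / ((σ - ε) * τ ^ 2)) ≤ r := by
  have hsqrt : 7 / 5 ≤ Real.sqrt n := by
    refine Real.le_sqrt_of_sq_le ?_
    have : (2 : ℝ) ≤ n := by exact_mod_cast hn
    linarith
  rw [hr, div_lt_one (by positivity)] at hr1
  have h1 : σ * τ ^ 2 ≤ σ := mul_le_of_le_one_right hσ.le (pow_le_one₀ hτ.le hτ1)
  have h2 : 4 * Real.sqrt n * ε ≤ 4 * Real.sqrt n * c * ε := by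
    have : 4 * Real.sqrt n * ε * 1 ≤ 4 * Real.sqrt n * ε * c :=
      mul_le_mul_of_nonneg_left hc (by positivity)
    linarith
  have h3 : 4 * Real.sqrt n * ε < σ := (h2.trans_lt hr1).trans_le h1
  have h4 : ε < σ := by nlinarith
  refine ⟨h4, ?_⟩
  have h5 : 0 < σ - ε := sub_pos.2 h4
  -- From `4 √n ε < σ` one gets `4 √n (σ - ε) ≥ (4 √n - 1) σ ≥ (23/5) σ`, using `√n ≥ 7/5`; this
  -- leaves room for the constant `9/2`.
  have h6 : 9 / 2 * σ ≤ 4 * Real.sqrt n * (σ - ε) := by nlinarith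
  rw [hr, ← mul_div_assoc, div_le_div_iff₀ (by positivity) (by positivity)]
  have h7 := mul_le_mul_of_nonneg_left h6 (show 0 ≤ c * ε * τ ^ 2 by positivity)
  linarith

theorem frobNorm_iterate_le {D : ℕ → Matrix (Fin n) (Fin n) ℝ} {r : ℝ} (hr : 0 ≤ r)
    (h : ∀ k, frobNorm (D (k + 1) - Dopt) ≤ r * frobNorm (D k - Dopt)) (k : ℕ) :
    frobNorm (D k - Dopt) ≤ r ^ k * frobNorm (D 0 - Dopt) := by
  induction k with
  | zero => simp
  | succ k ih =>
    refine (h k).trans ((mul_le_mul_of_nonneg_left ih hr).trans (le_of_eq ?_))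
    ring

/-- By the triangle inequality `(1 - r) ‖D - Dopt‖ ≤ tol`: the step length controls the error before
the step, and the step gains another factor `r`. -/
theorem frobNorm_sub_le_of_step {D D' : Matrix (Fin n) (Fin n) ℝ} {r tol : ℝ} (hr : 0 ≤ r)
    (hr1 : r < 1) (h : frobNorm (D' - Dopt) ≤ r * frobNorm (D - Dopt))
    (htol : frobNorm (D' - D) ≤ tol) : frobNorm (D' - Dopt) ≤ r / (1 - r) * tol := by
  have h1 : 0 < 1 - r := by linarith
  have h2 := frobNorm_add_le (D - D') (D' - Dopt)
  rw [sub_add_sub_cancel, frobNorm_sub_comm D D'] at h2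
  have h3 : (1 - r) * frobNorm (D - Dopt) ≤ tol := by linarith
  have h4 : frobNorm (D - Dopt) ≤ tol / (1 - r) := (le_div_iff₀' h1).2 h3
  refine h.trans ((mul_le_mul_of_nonneg_left h4 hr).trans (le_of_eq ?_))
  ring

end StructuredPseudospectrum

open StructuredPseudospectrum in
theorem mainTheorem1 {n : ℕ} (hn : 2 ≤ n) (A : Matrix (Fin n) (Fin n) ℝ)
    (S : PertStructure n) (ε : ℝ) (hε : 0 < ε)
    -- a worst-case structured perturbation of energy `ε`
    (Dopt : Matrix (Fin n) (Fin n) ℝ) (hD : IsWorstCase A S ε Dopt)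
    -- the rightmost eigenvalue (unique up to complex conjugation) is simple
    (lam : ℂ) (hlam : IsRightmost (A + Dopt) lam)
    (huniq : ∀ μ, IsRightmost (A + Dopt) μ → μ = lam ∨ μ = star lam)
    (hsimple : (toC (A + Dopt)).charpoly.rootMultiplicity lam = 1)
    (x y : Fin n → ℂ) (hxy : IsRPEigenpair (A + Dopt) lam x y)
    -- non-saturation
    (hsat : NonSaturated S (reOuter x y) Dopt)
    -- the denominator of the rate does not vanish
    (hσ : 0 < secondSmallestSingularValue (toC A - lam • (1 : Matrix (Fin n) (Fin n) ℂ))) :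
    -- a sensitivity constant exists
    (∃ c, IsSensitivityConstant S ε (reOuter x y) Dopt c) ∧
    ∃ K > 0, ∀ c, IsSensitivityConstant S ε (reOuter x y) Dopt c →
      ∀ r, r = rate A ε c lam x y → r < 1 →
      ∃ ρ > 0,
        -- from each matrix near `Dopt` every step can be carried out, and stays near `Dopt`
        (∀ D, twoNorm (D - Dopt) < ρ → ∀ μ, IsRightmost (A + D) μ →
          (∃ u v, IsRPEigenpair (A + D) μ u v) ∧
          ∀ u v, IsRPEigenpair (A + D) μ u v →
            ∃ t D', indexSetAlgorithm S ε (reOuter u v) = some (t, D') ∧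
              twoNorm (D' - Dopt) < ρ) ∧
        -- linear convergence at rate `r`, and the error at termination
        ∀ (D : ℕ → Matrix (Fin n) (Fin n) ℝ) (l : ℕ → ℂ) (u v : ℕ → Fin n → ℂ),
          IsIteration A S ε D l u v → twoNorm (D 0 - Dopt) < ρ →
          (∀ k, frobNorm (D (k + 1) - Dopt) ≤ r * frobNorm (D k - Dopt)) ∧
          (∀ k, |(l k).re - structAbscissa A S ε| ≤ K * r ^ k * frobNorm (D 0 - Dopt)) ∧
          Filter.Tendsto D Filter.atTop (nhds Dopt) ∧
          Filter.Tendsto (fun k => (l k).re) Filter.atTop (nhds (structAbscissa A S ε)) ∧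
          ∀ tol > 0, ∀ k, frobNorm (D (k + 1) - D k) ≤ tol →
            |(l (k + 1)).re - structAbscissa A S ε| ≤ K * (r / (1 - r) * tol) := by
  obtain ⟨s₀, hp⟩ := hxy.exists_isSimplePair hsimple
  have hopt := hD.isOptimizer hlam hp
  have hτ := hp.τ_pos
  have hτ1 := hp.τ_le_one
  obtain ⟨θ, hθ⟩ := hopt.exists_multiplier hε hsat
  refine ⟨⟨_, hθ.isSensitivityConstant hε⟩, 2 / (star y ⬝ᵥ x).re, by positivity,
    fun c hc r hr hr1 => ?_⟩
  have hc0 := hc.1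
  have hr0 : 0 < r := by
    rw [hr, rate]
    have : (0 : ℝ) < n := by exact_mod_cast (by omega : 0 < n)
    positivity
  obtain ⟨ρ, hρ, hstep⟩ : ∃ ρ > 0, ∀ D, twoNorm (D - Dopt) < ρ →
      StepContracts A Dopt S ε lam (2 / (star y ⬝ᵥ x).re) r D := by
    rcases hc.one_le_or hε hxy.frobNorm_le hopt hsat with h1 | ⟨δ, hδ, hconst⟩
    · obtain ⟨hlt, hle⟩ := rate_bound hn hε h1 hσ hτ hτ1 hr hr1
      exact hxy.exists_stepContracts hε hlam huniq
        (hxy.isSimplePair_of_singularValue hn hD.1.2 hlt) hopt hsat (mul_pos hc0 hε).le hle hc.2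
    -- Here `c` may be small, so `r < 1` need not give `ε < σ`; the lower bound `s₀` from simplicity
    -- is used, with contraction constant `0`.
    · refine hxy.exists_stepContracts hε hlam huniq hp hopt hsat le_rfl (by simpa using hr0.le)
        ⟨δ, hδ, fun M' _ hM' D' hD' => ?_⟩
      rw [hconst M' hM' D' hD', sub_self, frobNorm_zero, zero_mul]
  -- The step bounds the Frobenius norm of the new error by the 2-norm of the old one, so the 2-norm
  -- ball is invariant and the Frobenius errors contract by the same `r`.
  have hshrink : ∀ D D', twoNorm (D - Dopt) < ρ →
      frobNorm (D' - Dopt) ≤ r * twoNorm (D - Dopt) → twoNorm (D' - Dopt) < ρ :=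
    fun D D' hDρ h => by
      have := mul_le_mul_of_nonneg_right hr1.le (twoNorm_nonneg (D - Dopt))
      linarith [twoNorm_le_frobNorm (D' - Dopt)]
  refine ⟨ρ, hρ, fun D hDρ μ hμ => ?_, fun D l u v hit hD0 => ?_⟩
  · obtain ⟨-, h2, h3⟩ := hstep D hDρ μ hμ
    refine ⟨h2, fun u v huv => ?_⟩
    obtain ⟨t, D', hal, hle⟩ := h3 u v huv
    exact ⟨t, D', hal, hshrink D D' hDρ hle⟩
  · have hnext : ∀ k, twoNorm (D k - Dopt) < ρ →
        frobNorm (D (k + 1) - Dopt) ≤ r * twoNorm (D k - Dopt) := fun k hk => by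
      obtain ⟨hμ, hpair, t, hal⟩ := hit k
      obtain ⟨t', D', hal', hle⟩ := (hstep (D k) hk (l k) hμ).2.2 _ _ hpair
      rw [hal] at hal'
      obtain ⟨-, rfl⟩ := Prod.mk.inj (Option.some.inj hal')
      exact hle
    have hin : ∀ k, twoNorm (D k - Dopt) < ρ := fun k => by
      induction k with
      | zero => exact hD0
      | succ k ih => exact hshrink _ _ ih (hnext k ih)
    have hcontr : ∀ k, frobNorm (D (k + 1) - Dopt) ≤ r * frobNorm (D k - Dopt) := fun k =>
      (hnext k (hin k)).trans (mul_le_mul_of_nonneg_left (twoNorm_le_frobNorm _) hr0.le)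
    have hgeo := frobNorm_iterate_le hr0.le hcontr
    have hα := structAbscissa_eq hD hlam
    have hlip : ∀ k, |(l k).re - structAbscissa A S ε| ≤
        2 / (star y ⬝ᵥ x).re * frobNorm (D k - Dopt) := fun k => by
      rw [hα]
      exact (hstep _ (hin k) _ (hit k).1).1.trans
        (mul_le_mul_of_nonneg_left (twoNorm_le_frobNorm _) (by positivity))
    have hzero : Filter.Tendsto (fun k => frobNorm (D k - Dopt)) Filter.atTop (nhds 0) := by
      refine squeeze_zero (fun k => frobNorm_nonneg _) hgeo ?_
      simpa using (tendsto_pow_atTop_nhds_zero_of_lt_one hr0.le hr1).mul_const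
        (frobNorm (D 0 - Dopt))
    refine ⟨hcontr, fun k => ?_, tendsto_of_frobNorm hzero, ?_, fun tol _ k htol => ?_⟩
    · rw [mul_assoc]
      exact (hlip k).trans (mul_le_mul_of_nonneg_left (hgeo k) (by positivity))
    · rw [tendsto_iff_norm_sub_tendsto_zero]
      refine squeeze_zero (fun k => norm_nonneg _) hlip ?_
      simpa using hzero.const_mul (2 / (star y ⬝ᵥ x).re)
    · exact (hlip (k + 1)).trans (mul_le_mul_of_nonneg_left
        (frobNorm_sub_le_of_step hr0.le hr1 (hcontr k) htol) (by positivity))
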